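/- Let $d\ge 2$, let $\mathcal T_d$ be the $d$-regular rooted tree (its vertices are the finite words over an alphabet with $d$ letters, the root is the empty word, the children of a word $v$ are the words $vi$), let $L_n$ be its $n$-th level (words of length $n$), and let $G$ be a subgroup of the automorphism group $\mathrm{Aut}(\mathcal T_d)$. Let $\rho$ be the unitary representation of $G$ on $\ell^2(\mathcal T_d^0)$ ($\mathcal T_d^0$ being the vertex set) given by $(\rho(g)\xi)(v)=\xi(g^{-1}v)$, let $C^*_\rho(G)$ be the norm closure of $\rho(\mathbb C G)$ in $\mathcal B(\ell^2(\mathcal T_d^0))$, let $p_n$ be the orthogonal projection onto $\ell^2(L_n)$, and let $\mathcal R_n(G)=p_nC^*_\rho(G)p_n\subset\mathcal B(\ell^2(L_n))$. Let $Q_n:\ell^2(L_n)\to\ell^2(L_{n+1})$ be the isometry sending $\mathbf 1_{\{z\}}$ to $d^{-1/2}\,\mathbf 1_{C(z)}$, where $C(z)$ is the set of children of $z$, and let $q_{n+1}:\mathcal R_{n+1}(G)\to\mathcal R_n(G)$, $q_{n+1}(y)=Q_n^*\,y\,Q_n$, be the induced surjective $*$-homomorphism, which sends $p_{n+1}cp_{n+1}$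 to $p_ncp_n$ for $c\in C^*_\rho(G)$. Put \[ \mathcal S(G)=\Big\{(x_0,x_1,\dots)\ :\ x_n\in\mathcal R_n(G),\ q_{n+1}(x_{n+1})=x_n \text{ for all } n\ge 0,\ \sup_n\|x_n\|<\infty\Big\}, \] a unital $*$-algebra under componentwise operations. For $x\in\mathcal S(G)$ let $\mathrm{sp}(x)$ be its spectrum in $\mathcal S(G)$, and let $\mathrm{sp}(x_n)$ be the spectrum of $x_n$ as an operator on the finite-dimensional space $\ell^2(L_n)$. (i) If $x=(x_0,x_1,\dots)\in\mathcal S(G)$ is normal, then \[ \mathrm{sp}(x)=\overline{\bigcup_{n=0}^{\infty}\mathrm{sp}(x_n)}. \] (ii) Suppose that $G$ is finitely generated. Then this equality holds for every $x\in\mathcal S(G)$ (normal or not) if and only if $G$ is virtually abelian, i.e. has an abelian subgroup of finite index. -/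

import Mathlib

noncomputable section

namespace RootedTree

/-! ### The `d`-regular rooted tree and its automorphisms -/

/-- Vertices of the `d`-regular rooted tree: finite words in the alphabet `Fin d`;
the root is the empty word. -/
abbrev Vertex (d : ℕ) : Type := List (Fin d)

/-- The `d`-regular rooted tree: the children of a word `v` are the words `v ++ [i]`. -/
def tree (d : ℕ) : SimpleGraph (Vertex d) where
  Adj v w := (∃ i, w = v ++ [i]) ∨ ∃ i, v = w ++ [i]
  symm := ⟨fun _ _ h => h.symm⟩
  loopless := ⟨fun v h => by
    rcases h with ⟨i, h⟩ | ⟨i, h⟩ <;> simpa using congrArg List.length h⟩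

/-- The group of graph automorphisms of the tree, under composition. -/
abbrev TreeAut (d : ℕ) : Type := tree d ≃g tree d

/-- The `n`-th level: the words of length `n`, i.e. the vertices at distance `n` from the root. -/
abbrev Level (d n : ℕ) : Type := {v : Vertex d // v.length = n}

instance (d n : ℕ) : Fintype (Level d n) := inferInstanceAs (Fintype (List.Vector (Fin d) n))

instance (d n : ℕ) [NeZero d] : Nonempty (Level d n) := ⟨⟨List.replicate n 0, by simp⟩⟩

theorem adj_iff {d : ℕ} {v w : Vertex d} :
    (tree d).Adj v w ↔ (∃ i, w = v ++ [i]) ∨ ∃ i, v = w ++ [i] := Iff.rfl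

/-- Automorphisms fix the root, since it is the only vertex of degree `d`. -/
theorem aut_root {d : ℕ} (g : TreeAut d) : g [] = [] := by
  by_contra hne
  obtain ⟨u, j, hu⟩ : ∃ u j, g [] = u ++ [j] :=
    ⟨_, _, (List.dropLast_append_getLast hne).symm⟩
  have key : ∀ w, (tree d).Adj (g []) w → ∃ i : Fin d, w = g [i] := by
    intro w hw
    have h : (tree d).Adj [] (g.symm w) := by
      rw [← g.map_adj_iff]; simpa using hw
    rcases h with ⟨i, h⟩ | ⟨i, h⟩
    · exact ⟨i, by rw [List.nil_append] at h; rw [← h]; simp⟩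
    · exact absurd h (by simp)
  let nb : Option (Fin d) → Vertex d := fun o => o.elim u (fun i => g [] ++ [i])
  have hnb : ∀ o, (tree d).Adj (g []) (nb o) := by
    rintro (_ | i)
    · exact Or.inr ⟨j, hu⟩
    · exact Or.inl ⟨i, rfl⟩
  choose f hf using fun o => key _ (hnb o)
  have hinj : Function.Injective f := by
    intro a b hab
    have h : nb a = nb b := by rw [hf, hf, hab]
    rcases a with _ | a <;> rcases b with _ | b
    · rfl
    · have := congrArg List.length h
      simp [nb, hu] at this
    · have := congrArg List.length h
      simp [nb, hu] at this
    · simpa [nb] using h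
  have := Fintype.card_le_of_injective f hinj
  simp at this

/-- Automorphisms send the children of `v` to the children of the image of `v`. -/
theorem aut_child {d : ℕ} (g : TreeAut d) (v : Vertex d) :
    ∀ i, ∃ j, g (v ++ [i]) = g v ++ [j] := by
  induction v using List.reverseRecOn with
  | nil =>
    intro i
    have h : (tree d).Adj (g []) (g [i]) := g.map_adj_iff.2 (Or.inl ⟨i, rfl⟩)
    rw [aut_root] at h
    rcases h with ⟨j, h⟩ | ⟨j, h⟩
    · exact ⟨j, by simpa [aut_root] using h⟩
    · exact absurd h (by simp)
  | append_singleton t k ih =>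
    intro i
    have h : (tree d).Adj (g (t ++ [k])) (g (t ++ [k] ++ [i])) :=
      g.map_adj_iff.2 (Or.inl ⟨i, rfl⟩)
    rcases h with ⟨j, h⟩ | ⟨j, h⟩
    · exact ⟨j, h⟩
    · obtain ⟨l, hl⟩ := ih k
      rw [hl] at h
      have h2 := g.injective (List.append_inj_left' h rfl)
      have := congrArg List.length h2
      simp at this

/-- Automorphisms preserve the levels. -/
theorem aut_length {d : ℕ} (g : TreeAut d) (v : Vertex d) : (g v).length = v.length := by
  induction v using List.reverseRecOn with
  | nil => rw [aut_root]
  | append_singleton t k ih =>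
    obtain ⟨j, hj⟩ := aut_child g t k
    simp [hj, ih]

theorem aut_dropLast {d : ℕ} (g : TreeAut d) (v : Vertex d) :
    (g v).dropLast = g v.dropLast := by
  rcases List.eq_nil_or_concat v with rfl | ⟨u, i, rfl⟩
  · simp [aut_root]
  · obtain ⟨j, hj⟩ := aut_child g u i
    simp [hj]

/-! ### The fundamental representation and the fundamental C⋆-algebra -/

/-- The Hilbert space `ℓ²` of the vertex set of the tree. -/
abbrev EllTwo (d : ℕ) : Type := lp (fun _ : Vertex d => ℂ) 2

/-- The Hilbert space `ℓ²` of the `n`-th level. -/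
abbrev EllTwoLevel (d n : ℕ) : Type := EuclideanSpace ℂ (Level d n)

theorem memlp_two_iff {d : ℕ} (f : Vertex d → ℂ) :
    Memℓp f 2 ↔ Summable fun v => ‖f v‖ ^ 2 := by
  rw [memℓp_gen_iff (by norm_num)]
  simp

theorem ellTwo_norm_sq {d : ℕ} (ξ : EllTwo d) : ‖ξ‖ ^ 2 = ∑' v, ‖ξ v‖ ^ 2 := by
  have := lp.norm_rpow_eq_tsum (p := 2) (by norm_num) ξ
  simpa using this

/-- The operator `ξ ↦ ξ(g⁻¹ ·)`. -/
def translate {d : ℕ} (g : TreeAut d) : EllTwo d →ₗᵢ[ℂ] EllTwo d where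
  toFun ξ := ⟨fun v => ξ (g⁻¹ v), (memlp_two_iff _).2
    (((memlp_two_iff _).1 (lp.memℓp ξ)).comp_injective (g⁻¹).injective)⟩
  map_add' _ _ := rfl
  map_smul' _ _ := rfl
  norm_map' ξ := by
    refine (sq_eq_sq₀ (norm_nonneg _) (norm_nonneg _)).1 ?_
    rw [ellTwo_norm_sq, ellTwo_norm_sq]
    exact (g⁻¹).toEquiv.tsum_eq (fun v => ‖ξ v‖ ^ 2)

/-- The fundamental representation `ρ` of the full automorphism group on `ℓ²` of the tree:
`(ρ g ξ)(v) = ξ (g⁻¹ v)`. -/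
def rho (d : ℕ) : TreeAut d →* (EllTwo d →L[ℂ] EllTwo d) where
  toFun g := (translate g).toContinuousLinearMap
  map_one' := by ext ξ v; rfl
  map_mul' g h := by
    ext ξ v
    change ξ ((g * h)⁻¹ v) = ξ (h⁻¹ (g⁻¹ v))
    rw [mul_inv_rev]; rfl

@[simp] theorem rho_apply {d : ℕ} (g : TreeAut d) (ξ : EllTwo d) (v : Vertex d) :
    rho d g ξ v = ξ (g⁻¹ v) := rfl

theorem star_rho {d : ℕ} (g : TreeAut d) : star (rho d g) = rho d g⁻¹ := by
  rw [ContinuousLinearMap.star_eq_adjoint]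
  symm
  rw [ContinuousLinearMap.eq_adjoint_iff]
  intro ξ η
  have h : ξ = rho d g (rho d g⁻¹ ξ) := by
    rw [← mul_apply_eq_comp, ← map_mul, mul_inv_cancel, map_one]; rfl
  conv_rhs => rw [h]
  exact ((translate g).inner_map_map _ _).symm

/-- The image `ρ(ℂG)` of the group algebra, as a unital ⋆-subalgebra of the bounded operators. -/
def groupAlgebraImage {d : ℕ} (G : Subgroup (TreeAut d)) :
    StarSubalgebra ℂ (EllTwo d →L[ℂ] EllTwo d) where
  toSubalgebra := (MonoidAlgebra.lift ℂ (EllTwo d →L[ℂ] EllTwo d) G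
    ((rho d).comp G.subtype)).range
  star_mem' := by
    rintro _ ⟨a, rfl⟩
    induction a using MonoidAlgebra.induction_on with
    | of g =>
      refine ⟨MonoidAlgebra.of ℂ G g⁻¹, ?_⟩
      simp [star_rho]
    | add a b ha hb =>
      obtain ⟨a', ha'⟩ := ha
      obtain ⟨b', hb'⟩ := hb
      refine ⟨a' + b', ?_⟩
      simp only [map_add, star_add] at *
      rw [ha', hb']
    | smul c a ha =>
      obtain ⟨a', ha'⟩ := ha
      refine ⟨star c • a', ?_⟩
      have h : (MonoidAlgebra.lift ℂ (EllTwo d →L[ℂ] EllTwo d) G ((rho d).comp G.subtype)) a' =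
        star ((MonoidAlgebra.lift ℂ (EllTwo d →L[ℂ] EllTwo d) G ((rho d).comp G.subtype)) a) := ha'
      change (MonoidAlgebra.lift ℂ (EllTwo d →L[ℂ] EllTwo d) G ((rho d).comp G.subtype))
        (star c • a') = star ((MonoidAlgebra.lift ℂ (EllTwo d →L[ℂ] EllTwo d) G
          ((rho d).comp G.subtype)) (c • a))
      rw [map_smul, map_smul, star_smul, h]

/-- The fundamental C⋆-algebra of `G`: the norm closure of `ρ(ℂG)`. -/
def fundamentalCStar {d : ℕ} (G : Subgroup (TreeAut d)) :
    StarSubalgebra ℂ (EllTwo d →L[ℂ] EllTwo d) :=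
  (groupAlgebraImage G).topologicalClosure

theorem fundamentalCStar_induction {d : ℕ} {G : Subgroup (TreeAut d)}
    {S : Submodule ℂ (EllTwo d →L[ℂ] EllTwo d)} (hS : IsClosed (S : Set (EllTwo d →L[ℂ] EllTwo d)))
    (h : ∀ g ∈ G, rho d g ∈ S) {c : EllTwo d →L[ℂ] EllTwo d} (hc : c ∈ fundamentalCStar G) :
    c ∈ S := by
  have h1 : (groupAlgebraImage G : Set (EllTwo d →L[ℂ] EllTwo d)) ⊆ S := by
    rintro _ ⟨a, rfl⟩
    induction a using MonoidAlgebra.induction_on with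
    | of g => simpa using h g g.2
    | add a b ha hb => simpa using S.add_mem ha hb
    | smul c a ha => simpa using S.smul_mem c ha
  have hc' : c ∈ (fundamentalCStar G : Set (EllTwo d →L[ℂ] EllTwo d)) := hc
  rw [fundamentalCStar, StarSubalgebra.topologicalClosure_coe] at hc'
  exact closure_minimal h1 hS hc'

/-! ### Finite levels -/

/-- The projection `p n` of `ℓ²` of the tree onto `ℓ²` of the `n`-th level: the restriction of
functions to the level. Its adjoint is the extension of functions by zero. -/
def p (d n : ℕ) : EllTwo d →L[ℂ] EllTwoLevel d n :=
  LinearMap.mkContinuous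
    { toFun := fun ξ => WithLp.toLp 2 fun v => ξ v.1
      map_add' := fun _ _ => rfl
      map_smul' := fun _ _ => rfl } 1 (fun ξ => by
    rw [one_mul]
    refine (sq_le_sq₀ (norm_nonneg _) (norm_nonneg _)).1 ?_
    rw [EuclideanSpace.norm_sq_eq, ellTwo_norm_sq]
    have hs := (memlp_two_iff _).1 (lp.memℓp ξ)
    rw [← tsum_fintype (L := .unconditional _)]
    exact tsum_comp_le_tsum_of_inj hs (fun _ => by positivity) Subtype.val_injective)

@[simp] theorem p_apply {d n : ℕ} (ξ : EllTwo d) (v : Level d n) : p d n ξ v = ξ v.1 := rfl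

/-- The compression `p n x (p n)⋆` of an operator to the `n`-th level. -/
def compress {d : ℕ} (n : ℕ) (x : EllTwo d →L[ℂ] EllTwo d) :
    EllTwoLevel d n →L[ℂ] EllTwoLevel d n :=
  p d n ∘L x ∘L (p d n).adjoint

theorem p_adjoint_apply {d n : ℕ} (f : EllTwoLevel d n) (v : Vertex d) :
    (p d n).adjoint f v = if h : v.length = n then f ⟨v, h⟩ else 0 := by
  have h1 : inner ℂ (lp.single 2 v (1 : ℂ)) ((p d n).adjoint f) = (p d n).adjoint f v := by
    rw [lp.inner_single_left]; simp
  rw [← h1, ContinuousLinearMap.adjoint_inner_right, PiLp.inner_apply]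
  split_ifs with h
  · rw [Finset.sum_eq_single ⟨v, h⟩]
    · simp
    · intro w _ hw
      have : w.1 ≠ v := fun e => hw (Subtype.ext e)
      simp [this]
    · simp
  · refine Finset.sum_eq_zero fun w _ => ?_
    have : w.1 ≠ v := fun e => h (e ▸ w.2)
    simp [this]

theorem p_adjoint_p_apply {d n : ℕ} (ξ : EllTwo d) (v : Vertex d) :
    (p d n).adjoint (p d n ξ) v = if v.length = n then ξ v else 0 := by
  rw [p_adjoint_apply]
  split_ifs <;> rfl

theorem p_p_adjoint (d n : ℕ) : p d n ∘L (p d n).adjoint = 1 := by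
  ext f v
  simp [p_adjoint_apply, v.2]

/-- Elements of the fundamental C⋆-algebra commute with the projection onto a level. -/
theorem commute_level {d : ℕ} {G : Subgroup (TreeAut d)} (n : ℕ)
    {c : EllTwo d →L[ℂ] EllTwo d} (hc : c ∈ fundamentalCStar G) :
    c ∘L ((p d n).adjoint ∘L p d n) = ((p d n).adjoint ∘L p d n) ∘L c := by
  let E := (p d n).adjoint ∘L p d n
  let S : Submodule ℂ (EllTwo d →L[ℂ] EllTwo d) :=
    { carrier := {c | c * E = E * c}
      add_mem' := fun {a b} ha hb => by
        simp only [Set.mem_ofPred_eq] at *; rw [add_mul, mul_add, ha, hb]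
      zero_mem' := by simp
      smul_mem' := fun k a ha => by
        simp only [Set.mem_ofPred_eq] at *; rw [smul_mul_assoc, mul_smul_comm, ha] }
  have hS : IsClosed (S : Set (EllTwo d →L[ℂ] EllTwo d)) :=
    isClosed_eq (continuous_id.mul continuous_const) (continuous_const.mul continuous_id)
  refine fundamentalCStar_induction (G := G) (S := S) hS (fun g _ => ?_) hc
  change rho d g * E = E * rho d g
  ext ξ v
  simp [E, p_adjoint_p_apply, aut_length]

theorem compress_mul {d : ℕ} {G : Subgroup (TreeAut d)} (n : ℕ)
    {c c' : EllTwo d →L[ℂ] EllTwo d} (hc' : c' ∈ fundamentalCStar G) :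
    compress n (c * c') = compress n c * compress n c' := by
  have h := commute_level n hc'
  ext1 f
  have h2 := congrArg (fun T => p d n (c (T ((p d n).adjoint f)))) h
  have h3 := congrArg (fun T => T f) (p_p_adjoint d n)
  simp only [ContinuousLinearMap.comp_apply, one_apply_eq_self] at h2 h3
  rw [h3] at h2
  simpa [compress] using h2

/-- The finite-dimensional C⋆-algebra `R n = p n C⋆(G) p n` of operators on `ℓ²` of the `n`-th
level. -/
def levelAlgebra {d : ℕ} (G : Subgroup (TreeAut d)) (n : ℕ) :
    StarSubalgebra ℂ (EllTwoLevel d n →L[ℂ] EllTwoLevel d n) where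
  carrier := compress n '' (fundamentalCStar G : Set (EllTwo d →L[ℂ] EllTwo d))
  mul_mem' := by
    rintro _ _ ⟨c, hc, rfl⟩ ⟨c', hc', rfl⟩
    exact ⟨c * c', mul_mem hc hc', compress_mul n hc'⟩
  add_mem' := by
    rintro _ _ ⟨c, hc, rfl⟩ ⟨c', hc', rfl⟩
    exact ⟨c + c', add_mem hc hc', by simp [compress]⟩
  algebraMap_mem' k := by
    refine ⟨algebraMap ℂ _ k, algebraMap_mem _ k, ?_⟩
    rw [Algebra.algebraMap_eq_smul_one, Algebra.algebraMap_eq_smul_one, ← p_p_adjoint d n]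
    ext1 f
    simp [compress]
  star_mem' := by
    rintro _ ⟨c, hc, rfl⟩
    refine ⟨star c, star_mem hc, ?_⟩
    simp [compress, ContinuousLinearMap.star_eq_adjoint, ContinuousLinearMap.adjoint_comp,
      ContinuousLinearMap.comp_assoc]

/-! ### The maps between consecutive levels -/

/-- The parent of a vertex of level `n + 1`. -/
def parent {d n : ℕ} (w : Level d (n + 1)) : Level d n :=
  ⟨w.1.dropLast, by simp [w.2]⟩

/-- A vertex of level `n + 1` is a vertex of level `n` together with a last letter. -/
def childEquiv (d n : ℕ) : Level d n × Fin d ≃ Level d (n + 1) where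
  toFun vi := ⟨vi.1.1 ++ [vi.2], by simp [vi.1.2]⟩
  invFun w := (parent w, w.1.getLast (by intro h; simpa [h] using w.2))
  left_inv := by rintro ⟨⟨v, hv⟩, i⟩; simp [parent]
  right_inv w := Subtype.ext (List.dropLast_append_getLast _)

theorem parent_childEquiv {d n : ℕ} (vi : Level d n × Fin d) :
    parent (childEquiv d n vi) = vi.1 := by
  apply Subtype.ext; simp [parent, childEquiv]

/-- The isometry `Q n` from `ℓ²` of level `n` into `ℓ²` of level `n + 1`, sending the indicator of
a vertex `z` to `1/√d` times the indicator of the set of children of `z`. -/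
def Q (d n : ℕ) : EllTwoLevel d n →L[ℂ] EllTwoLevel d (n + 1) :=
  LinearMap.toContinuousLinearMap
    { toFun := fun f => WithLp.toLp 2 fun w => ((Real.sqrt d : ℝ) : ℂ)⁻¹ * f (parent w)
      map_add' := fun f g => by ext w; simp [mul_add]
      map_smul' := fun c f => by ext w; simp [mul_left_comm] }

@[simp] theorem Q_apply {d n : ℕ} (f : EllTwoLevel d n) (w : Level d (n + 1)) :
    Q d n f w = ((Real.sqrt d : ℝ) : ℂ)⁻¹ * f (parent w) := rfl

theorem Q_single {d n : ℕ} (z : Level d n) :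
    Q d n (EuclideanSpace.single z 1) =
      ((Real.sqrt d : ℝ) : ℂ)⁻¹ • WithLp.toLp 2 ({w | parent w = z}.indicator 1) := by
  ext w
  simp [Set.indicator_apply]

theorem Q_adjoint_Q (d n : ℕ) [NeZero d] : (Q d n).adjoint ∘L Q d n = 1 := by
  refine (ContinuousLinearMap.norm_map_iff_adjoint_comp_self _).1 fun f => ?_
  refine (sq_eq_sq₀ (norm_nonneg _) (norm_nonneg _)).1 ?_
  rw [EuclideanSpace.norm_sq_eq, EuclideanSpace.norm_sq_eq, ← (childEquiv d n).sum_comp,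
    Fintype.sum_prod_type]
  have hd : (d : ℝ) ≠ 0 := by exact_mod_cast NeZero.ne d
  refine Finset.sum_congr rfl fun v _ => ?_
  simp only [Q_apply, parent_childEquiv, Finset.sum_const, Finset.card_univ, Fintype.card_fin,
    nsmul_eq_mul, norm_mul, mul_pow, norm_inv, Complex.norm_real, Real.norm_eq_abs, sq_abs,
    inv_pow, Real.sq_sqrt (Nat.cast_nonneg d)]
  rw [← mul_assoc, mul_inv_cancel₀ hd, one_mul]

/-- The map `q` from operators on level `n + 1` to operators on level `n` obtained by compressing
along the isometry `Q n`. -/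
def q {d : ℕ} (n : ℕ) (y : EllTwoLevel d (n + 1) →L[ℂ] EllTwoLevel d (n + 1)) :
    EllTwoLevel d n →L[ℂ] EllTwoLevel d n :=
  (Q d n).adjoint ∘L y ∘L Q d n

theorem q_add {d n : ℕ} (y z : EllTwoLevel d (n + 1) →L[ℂ] EllTwoLevel d (n + 1)) :
    q n (y + z) = q n y + q n z := by
  simp [q]

theorem q_star {d n : ℕ} (y : EllTwoLevel d (n + 1) →L[ℂ] EllTwoLevel d (n + 1)) :
    q n (star y) = star (q n y) := by
  simp [q, ContinuousLinearMap.star_eq_adjoint, ContinuousLinearMap.adjoint_comp,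
    ContinuousLinearMap.comp_assoc]

/-- `Q n` intertwines the actions of the fundamental C⋆-algebra on consecutive levels. -/
theorem compress_Q {d : ℕ} {G : Subgroup (TreeAut d)} (n : ℕ)
    {c : EllTwo d →L[ℂ] EllTwo d} (hc : c ∈ fundamentalCStar G) :
    compress (n + 1) c ∘L Q d n = Q d n ∘L compress n c := by
  let S : Submodule ℂ (EllTwo d →L[ℂ] EllTwo d) :=
    { carrier := {c | compress (n + 1) c ∘L Q d n = Q d n ∘L compress n c}
      add_mem' := fun {a b} ha hb => by
        simp only [Set.mem_ofPred_eq, compress, ContinuousLinearMap.add_comp,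
          ContinuousLinearMap.comp_add] at *
        rw [ha, hb]
      zero_mem' := by simp [compress]
      smul_mem' := fun k a ha => by
        simp only [Set.mem_ofPred_eq, compress, ContinuousLinearMap.smul_comp,
          ContinuousLinearMap.comp_smul] at *
        rw [ha] }
  have hS : IsClosed (S : Set (EllTwo d →L[ℂ] EllTwo d)) := by
    refine isClosed_eq ?_ ?_ <;> unfold compress <;> fun_prop
  refine fundamentalCStar_induction (G := G) (S := S) hS (fun g _ => ?_) hc
  change compress (n + 1) (rho d g) ∘L Q d n = Q d n ∘L compress n (rho d g)
  ext f w
  have h1 : (g⁻¹ w.1).length = n + 1 := by rw [aut_length, w.2]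
  have h2 : (g⁻¹ (parent w).1).length = n := by rw [aut_length, (parent w).2]
  simp only [compress, ContinuousLinearMap.comp_apply, p_apply, rho_apply, p_adjoint_apply, h1,
    h2, dif_pos, Q_apply]
  have h3 : parent (⟨g⁻¹ w.1, h1⟩ : Level d (n + 1)) = ⟨g⁻¹ (parent w).1, h2⟩ :=
    Subtype.ext (aut_dropLast g⁻¹ w.1)
  rw [h3]

/-- `q` maps `R (n + 1)` to `R n`, sending the compression of `c` to the compression of `c`. -/
theorem q_compress {d : ℕ} [NeZero d] {G : Subgroup (TreeAut d)} (n : ℕ)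
    {c : EllTwo d →L[ℂ] EllTwo d} (hc : c ∈ fundamentalCStar G) :
    q n (compress (n + 1) c) = compress n c := by
  rw [q, compress_Q n hc, ← ContinuousLinearMap.comp_assoc, Q_adjoint_Q]
  rfl

theorem q_mul {d : ℕ} [NeZero d] {G : Subgroup (TreeAut d)} (n : ℕ)
    {y z : EllTwoLevel d (n + 1) →L[ℂ] EllTwoLevel d (n + 1)}
    (hy : y ∈ levelAlgebra G (n + 1)) (hz : z ∈ levelAlgebra G (n + 1)) :
    q n (y * z) = q n y * q n z := by
  obtain ⟨c, hc, rfl⟩ := hy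
  obtain ⟨c', hc', rfl⟩ := hz
  rw [← compress_mul _ hc', q_compress n (mul_mem hc hc'), q_compress n hc, q_compress n hc',
    compress_mul _ hc']

/-! ### The von Neumann algebra -/

/-- The algebra of all bounded operators on `ℓ²` of the `n`-th level. -/
abbrev LevelOp (d n : ℕ) : Type := EllTwoLevel d n →L[ℂ] EllTwoLevel d n

/-- The von Neumann algebra `S(G)`: the sequences `(x 0, x 1, …)` with `x n ∈ R n` and
`q (x (n + 1)) = x n` for all `n` and with `sup n, ‖x n‖ < ∞`, with componentwise operations. -/
def vonNeumann {d : ℕ} [NeZero d] (G : Subgroup (TreeAut d)) :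
    StarSubalgebra ℂ (∀ n, LevelOp d n) where
  carrier := {x | (∀ n, x n ∈ levelAlgebra G n) ∧ (∀ n, q n (x (n + 1)) = x n) ∧
    ∃ C : ℝ, ∀ n, ‖x n‖ ≤ C}
  mul_mem' := by
    rintro x y ⟨hx, hxq, C, hC⟩ ⟨hy, hyq, D, hD⟩
    refine ⟨fun n => mul_mem (hx n) (hy n), fun n => ?_, C * D, fun n => ?_⟩
    · rw [Pi.mul_apply, Pi.mul_apply, q_mul n (hx (n + 1)) (hy (n + 1)), hxq, hyq]
    · exact (norm_mul_le _ _).trans (mul_le_mul (hC n) (hD n) (norm_nonneg _)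
        ((norm_nonneg _).trans (hC n)))
  add_mem' := by
    rintro x y ⟨hx, hxq, C, hC⟩ ⟨hy, hyq, D, hD⟩
    refine ⟨fun n => add_mem (hx n) (hy n), fun n => ?_, C + D, fun n => ?_⟩
    · rw [Pi.add_apply, Pi.add_apply, q_add, hxq, hyq]
    · exact (norm_add_le _ _).trans (add_le_add (hC n) (hD n))
  algebraMap_mem' k := by
    refine ⟨fun n => algebraMap_mem (levelAlgebra G n) k, fun n => ?_, ‖k‖, fun n => ?_⟩
    · rw [Pi.algebraMap_apply, Pi.algebraMap_apply, Algebra.algebraMap_eq_smul_one,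
        Algebra.algebraMap_eq_smul_one, ← Q_adjoint_Q d n]
      ext1 f
      simp [q]
    · rw [Pi.algebraMap_apply, norm_algebraMap']
  star_mem' := by
    rintro x ⟨hx, hxq, C, hC⟩
    refine ⟨fun n => star_mem (hx n), fun n => ?_, C, fun n => ?_⟩
    · rw [Pi.star_apply, Pi.star_apply, q_star, hxq]
    · exact (norm_star (x n)).trans_le (hC n)

end RootedTree

/-- A group is virtually abelian if it has an abelian subgroup of finite index. -/
def IsVirtuallyAbelian (Γ : Type*) [Group Γ] : Prop :=
  ∃ H : Subgroup Γ, H.FiniteIndex ∧ ∀ a ∈ H, ∀ b ∈ H, a * b = b * a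

end

/-! An element of `S(G)` is invertible exactly when its components are bounded below by one common
constant: the inverses of the components lie in the level algebras and are automatically compatible
with `q` (`isUnit_vonNeumann_iff`). Hence the closure of the union of the component spectra always
lies in the spectrum, and equality can fail only if, at some point at positive distance from all
component spectra, the resolvents of the components are unbounded. For normal components the
resolvent is bounded by the inverse of the distance, which gives (i).

If `G` has an abelian subgroup of index `m`, each level splits orthogonally into irreducible pieces
of dimension at most `m` (`finrank_le_index`). In bounded dimension, Cayley–Hamilton bounds the
inverse of an operator in terms of its norm and a lower bound on its eigenvalues
(`exists_norm_le_of_finrank_le`).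

For the converse the test elements are nilpotent contractions. The kernel of `q` is cut out by a
central projection, so `R (n + 1)` is the direct sum of this kernel and a copy of `R n`. One can
therefore build a single sequence of nilpotent contractions in `S(G)` whose new summand at each
level is nearly the worst one for the size of `(1 - a)⁻¹`. Its component spectra lie in `{0}`, so
the assumed equality keeps `1` out of its spectrum, and this bounds `(1 - a)⁻¹` for all nilpotent
contractions on all levels (`exists_nilpotent_bound`). By Burnside's theorem an irreducible piece of
dimension `k` supports the shift, whose `(1 - a)⁻¹` has norm at least `√k`; so the dimensions are
bounded. Jordan's theorem then yields, for each irreducible piece, a subgroup of `G` of bounded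
index acting on it by commuting operators. As `G` is finitely generated, one finite-index subgroup
lies in all of these. Its commutators act trivially on every level, so it is abelian. -/

noncomputable section

/-! ### Ideals and splittings in finite-dimensional C⋆-algebras -/

section FiniteDimensionalCStarAlgebra

variable {A B : Type*} [CStarAlgebra A] [FiniteDimensional ℂ A] [CStarAlgebra B]

/-- In a finite-dimensional C⋆-algebra, left multiplication by a self-adjoint element has
complementary kernel and range; so such an element has a right unit among its right multiples. -/
theorem IsSelfAdjoint.exists_mul_mul_eq_self {a : A} (ha : IsSelfAdjoint a) :
    ∃ g : A, a * (a * g) = a := by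
  let L : A →ₗ[ℂ] A := LinearMap.mulLeft ℂ a
  -- If `a * (a * x) = 0`, then `star (a * x) * (a * x) = star x * (a * (a * x)) = 0`, so `a * x =
  -- 0` by the C⋆-identity.
  have hker : Disjoint (LinearMap.range L) (LinearMap.ker L) := by
    rw [Submodule.disjoint_def]
    rintro _ ⟨x, rfl⟩ hx
    have hx' : a * (a * x) = 0 := hx
    change a * x = 0
    rw [← CStarRing.star_mul_self_eq_zero_iff, star_mul, ha.star_eq, mul_assoc, hx', mul_zero]
  have hinj : Function.Injective (L.domRestrict (LinearMap.range L)) := by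
    rw [← LinearMap.ker_eq_bot, LinearMap.ker_eq_bot']
    exact fun x hx => Subtype.ext (Submodule.disjoint_def.1 hker _ x.2 hx)
  have hinj' : Function.Injective (L.restrict (p := LinearMap.range L) (q := LinearMap.range L)
      fun x _ => ⟨x, rfl⟩) := by
    intro x y hxy
    exact hinj (congrArg Subtype.val hxy)
  obtain ⟨⟨_, g, rfl⟩, hx⟩ := LinearMap.injective_iff_surjective.1 hinj' ⟨a, 1, mul_one a⟩
  exact ⟨g, congrArg Subtype.val hx⟩

/-- A `⋆`-homomorphism on a finite-dimensional C⋆-algebra has a kernel with a unit, which is a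
central projection. -/
theorem StarAlgHom.exists_unit_ker (φ : A →⋆ₐ[ℂ] B) :
    ∃ e : A, IsSelfAdjoint e ∧ e * e = e ∧ φ e = 0 ∧ (∀ a, φ a = 0 → e * a = a) ∧
      ∀ a, e * a = a * e := by
  let I : Submodule ℂ A := LinearMap.ker (φ : A →ₗ[ℂ] B)
  have hI : ∀ a, a ∈ I ↔ φ a = 0 := fun a => Iff.rfl
  let b := Module.finBasis ℂ I
  -- This positive element generates the kernel as a right ideal: whatever it annihilates from the
  -- left is annihilated by every `star (b i)`. The unit is `e = a * g`, where `a * e = a`.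
  let a : A := ∑ i, (b i : A) * star (b i : A)
  have haI : φ a = 0 := by
    simp only [a, map_sum, map_mul]
    exact Finset.sum_eq_zero fun i _ => by rw [(hI _).1 (b i).2, zero_mul]
  have ha : IsSelfAdjoint a := isSelfAdjoint_sum _ fun i _ => IsSelfAdjoint.mul_star_self _
  obtain ⟨g, hg⟩ := ha.exists_mul_mul_eq_self
  let e := a * g
  have heI : φ e = 0 := by simp [e, haI]
  -- Expanding `star (1 - e) * a * (1 - e) = 0` gives a vanishing sum of positive elements, so each
  -- of them vanishes.
  have hbi : ∀ i, star (b i : A) * (1 - e) = 0 := by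
    let := CStarAlgebra.spectralOrder A
    let := CStarAlgebra.spectralOrderedRing A
    have h0 : ∑ i, star (star (b i : A) * (1 - e)) * (star (b i : A) * (1 - e)) = 0 := by
      have h : star (1 - e) * (a * (1 - e)) = 0 := by rw [mul_sub, hg, mul_one, sub_self, mul_zero]
      rw [← h]
      simp only [a, Finset.mul_sum, Finset.sum_mul, star_mul, star_star, mul_assoc]
    intro i
    rw [← CStarRing.star_mul_self_eq_zero_iff]
    exact (Finset.sum_eq_zero_iff_of_nonneg fun i _ => star_mul_self_nonneg _).1 h0 i
      (Finset.mem_univ i)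
  have hleft : ∀ x, φ x = 0 → star (1 - e) * x = 0 := by
    intro x hx
    have hx' : x ∈ I := hx
    have := congrArg (Submodule.subtype I) (b.sum_repr ⟨x, hx'⟩)
    simp only [map_sum, map_smul, Submodule.subtype_apply] at this
    rw [← this, Finset.mul_sum]
    refine Finset.sum_eq_zero fun i _ => ?_
    have := congrArg star (hbi i)
    rw [star_mul, star_star, star_zero] at this
    rw [mul_smul_comm, this, smul_zero]
  have hstar : ∀ x, φ x = 0 → star e * x = x := by
    intro x hx
    have := hleft x hx
    rwa [star_sub, star_one, sub_mul, one_mul, sub_eq_zero, eq_comm] at this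
  have hsa : IsSelfAdjoint e := by
    have h := hstar e heI
    rw [← h]
    exact IsSelfAdjoint.star_mul_self e
  have hunit : ∀ x, φ x = 0 → e * x = x := by
    intro x hx
    have := hstar x hx
    rwa [hsa.star_eq] at this
  have hunit' : ∀ x, φ x = 0 → x * e = x := by
    intro x hx
    have := congrArg star (hunit (star x) (by rw [map_star, hx, star_zero]))
    rwa [star_mul, star_star, hsa.star_eq] at this
  refine ⟨e, hsa, hunit e heI, heI, hunit, fun x => ?_⟩
  -- Both `x * e` and `e * x` lie in the kernel, so each equals `e * x * e`.
  rw [← hunit (x * e) (by rw [map_mul, heI, mul_zero]), ← mul_assoc,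
    hunit' (e * x) (by rw [map_mul, heI, zero_mul])]

/-- A surjective `⋆`-homomorphism from a finite-dimensional C⋆-algebra is split by a non-unital
`⋆`-homomorphism, onto the complement of a central projection. -/
theorem StarAlgHom.exists_section (φ : A →⋆ₐ[ℂ] B) (hφ : Function.Surjective φ) :
    ∃ (s : B →⋆ₙₐ[ℂ] A) (e : A), IsSelfAdjoint e ∧ e * e = e ∧ φ e = 0 ∧
      (∀ a, φ a = 0 → e * a = a) ∧ (∀ a, e * a = a * e) ∧ (∀ a, s (φ a) = (1 - e) * a) ∧
      ∀ b, φ (s b) = b := by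
  obtain ⟨e, hsa, hee, he, hunit, hcomm⟩ := φ.exists_unit_ker
  -- The element `(1 - e) * x` depends only on `φ x`. So an arbitrary set-theoretic preimage `r b`
  -- gives a well-defined section, and its algebraic identities can be checked after applying `φ`.
  have hwd : ∀ x y, φ x = φ y → (1 - e) * x = (1 - e) * y := by
    intro x y hxy
    rw [← sub_eq_zero, ← mul_sub, sub_mul, one_mul,
      hunit _ (by rw [map_sub, hxy, sub_self]), sub_self]
  have h1e : (1 - e) * (1 - e) = 1 - e := by
    rw [mul_sub, sub_mul, sub_mul, hee]; simp
  have hc : ∀ x, (1 - e) * x = x * (1 - e) := fun x => by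
    rw [sub_mul, mul_sub, hcomm, one_mul, mul_one]
  let r := Function.surjInv hφ
  have hr : ∀ b, φ (r b) = b := Function.surjInv_eq hφ
  refine ⟨{ toFun := fun b => (1 - e) * r b
            map_smul' := fun c x => ?_
            map_zero' := ?_
            map_add' := fun x y => ?_
            map_mul' := fun x y => ?_
            map_star' := fun x => ?_ }, e, hsa, hee, he, hunit, hcomm, fun a => ?_, fun b => ?_⟩
  · change (1 - e) * r (c • x) = c • ((1 - e) * r x)
    rw [← mul_smul_comm]
    exact hwd _ _ (by rw [map_smul, hr, hr])
  · change (1 - e) * r 0 = 0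
    rw [hwd (r 0) 0 (by rw [hr, map_zero]), mul_zero]
  · change (1 - e) * r (x + y) = (1 - e) * r x + (1 - e) * r y
    rw [← mul_add]
    exact hwd _ _ (by rw [map_add, hr, hr, hr])
  · change (1 - e) * r (x * y) = (1 - e) * r x * ((1 - e) * r y)
    rw [hwd (r (x * y)) (r x * r y) (by rw [map_mul, hr, hr, hr]), hc (r x), mul_assoc,
      ← mul_assoc (1 - e) (1 - e), h1e, ← mul_assoc, hc, mul_assoc, hc (r y)]
  · rw [star_mul, star_sub, star_one, hsa.star_eq, ← hc]
    exact hwd _ _ (by rw [map_star, hr, hr])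
  · exact hwd _ _ (hr _)
  · change φ ((1 - e) * r b) = b
    rw [map_mul, map_sub, he, map_one, sub_zero, one_mul, hr]

end FiniteDimensionalCStarAlgebra

/-! ### Invariant subspaces and Burnside's theorem -/

section InvariantSubspaces

variable {E : Type*} [NormedAddCommGroup E] [InnerProductSpace ℂ E]

/-- A subspace is invariant under a set of operators. -/
def IsInvariantUnder (T : Set (E →L[ℂ] E)) (W : Submodule ℂ E) : Prop :=
  ∀ a ∈ T, ∀ v ∈ W, a v ∈ W

/-- A subspace is minimal among the nonzero subspaces invariant under a set of operators. -/
structure IsMinimalInvariant (T : Set (E →L[ℂ] E)) (W : Submodule ℂ E) : Prop where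
  invariant : IsInvariantUnder T W
  ne_bot : W ≠ ⊥
  eq_of_le : ∀ U ≤ W, IsInvariantUnder T U → U ≠ ⊥ → U = W

theorem IsInvariantUnder.orthogonal [CompleteSpace E] {T : Set (E →L[ℂ] E)}
    (hT : ∀ a ∈ T, star a ∈ T)
    {W : Submodule ℂ E} (hW : IsInvariantUnder T W) : IsInvariantUnder T Wᗮ := by
  intro a ha v hv
  rw [Submodule.mem_orthogonal] at hv ⊢
  intro u hu
  rw [← ContinuousLinearMap.adjoint_inner_left, ← ContinuousLinearMap.star_eq_adjoint]
  exact hv _ (hW _ (hT a ha) u hu)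

variable [FiniteDimensional ℂ E]

theorem IsInvariantUnder.exists_isMinimalInvariant {T : Set (E →L[ℂ] E)} {V : Submodule ℂ E}
    (hV : IsInvariantUnder T V) (h0 : V ≠ ⊥) : ∃ W ≤ V, IsMinimalInvariant T W := by
  obtain ⟨W, ⟨hWV, hW, hW0⟩, hmin⟩ := WellFounded.has_min
    (wellFounded_lt (α := Submodule ℂ E)) {W | W ≤ V ∧ IsInvariantUnder T W ∧ W ≠ ⊥}
    ⟨V, le_rfl, hV, h0⟩
  refine ⟨W, hWV, hW, hW0, fun U hU hUi hU0 => ?_⟩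
  by_contra hne
  exact hmin U ⟨hU.trans hWV, hUi, hU0⟩ (lt_of_le_of_ne hU hne)

variable [CompleteSpace E]

/-- Induction on the dimension of a subspace invariant under a self-adjoint set of operators, by
splitting off minimal invariant subspaces. -/
theorem IsInvariantUnder.induction {T : Set (E →L[ℂ] E)} (hT : ∀ a ∈ T, star a ∈ T)
    {P : Submodule ℂ E → Prop} (h0 : P ⊥)
    (hstep : ∀ V U, IsMinimalInvariant T U → U ≤ V → P (Uᗮ ⊓ V) → P V)
    {V : Submodule ℂ E} (hV : IsInvariantUnder T V) : P V := by
  induction V using WellFoundedLT.induction with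
  | ind V ih =>
    by_cases hV0 : V = ⊥
    · rwa [hV0]
    obtain ⟨U, hUV, hU⟩ := hV.exists_isMinimalInvariant hV0
    refine hstep V U hU hUV (ih _ (lt_of_le_of_ne inf_le_right fun h => hU.ne_bot ?_) ?_)
    · have h1 : U ≤ Uᗮ := hUV.trans (h ▸ inf_le_left)
      rw [eq_bot_iff, ← Submodule.inf_orthogonal_eq_bot U]
      exact le_inf le_rfl h1
    · exact fun a ha v hv => ⟨hU.invariant.orthogonal hT a ha v hv.1, hV a ha v hv.2⟩

instance StarSubalgebra.finiteDimensional_of_operators (A : StarSubalgebra ℂ (E →L[ℂ] E)) :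
    FiniteDimensional ℂ A :=
  FiniteDimensional.of_injective (A.subtype : A →ₗ[ℂ] (E →L[ℂ] E)) Subtype.val_injective

instance StarSubalgebra.isClosed_of_operators (A : StarSubalgebra ℂ (E →L[ℂ] E)) :
    IsClosed (A : Set (E →L[ℂ] E)) :=
  Submodule.closed_of_finiteDimensional (Subalgebra.toSubmodule A.toSubalgebra)

variable (A : StarSubalgebra ℂ (E →L[ℂ] E)) {W : Submodule ℂ E}

/-- The restriction of a `⋆`-algebra of operators to an invariant subspace. -/
def restrictHom (hW : IsInvariantUnder (A : Set (E →L[ℂ] E)) W) : A →⋆ₐ[ℂ] (W →L[ℂ] W) where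
  toFun a := (a.1 ∘L W.subtypeL).codRestrict W fun v => hW a.1 a.2 v v.2
  map_one' := rfl
  map_mul' _ _ := rfl
  map_zero' := rfl
  map_add' _ _ := rfl
  commutes' _ := rfl
  map_star' a := by
    rw [ContinuousLinearMap.star_eq_adjoint, ContinuousLinearMap.eq_adjoint_iff]
    intro x y
    change inner ℂ ((star a.1) x : E) (y : E) = inner ℂ (x : E) (a.1 y)
    rw [ContinuousLinearMap.star_eq_adjoint, ContinuousLinearMap.adjoint_inner_left]

@[simp] theorem coe_restrictHom_apply (hW : IsInvariantUnder (A : Set (E →L[ℂ] E)) W) (a : A)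
    (v : W) : (restrictHom A hW a v : E) = a.1 v := rfl

/-- **Burnside's theorem** for `⋆`-algebras of operators: the restriction to a minimal invariant
subspace contains all operators. -/
theorem restrictHom_surjective (hW : IsMinimalInvariant (A : Set (E →L[ℂ] E)) W) :
    Function.Surjective (restrictHom A hW.invariant) := by
  let _ : Module A W := Module.compHom W (restrictHom A hW.invariant : A →+* (W →L[ℂ] W))
  have : IsScalarTower ℂ A W := ⟨fun c a v => rfl⟩
  have : IsSimpleModule A W := by
    have hnt : Nontrivial W := Submodule.nontrivial_iff_ne_bot.2 hW.ne_bot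
    have : Nontrivial (Submodule A W) := inferInstance
    rw [isSimpleModule_iff]
    refine ⟨fun U => ?_⟩
    rw [or_iff_not_imp_left]
    intro hU
    let U' : Submodule ℂ E := (U.restrictScalars ℂ).map W.subtype
    have h1 : U' = W := by
      refine hW.eq_of_le U' (Submodule.map_subtype_le _ _) ?_ ?_
      · rintro a ha _ ⟨v, hv, rfl⟩
        exact ⟨(⟨a, ha⟩ : A) • v, U.smul_mem _ hv, rfl⟩
      · obtain ⟨u, hu, hu0⟩ := Submodule.exists_mem_ne_zero_of_ne_bot hU
        intro h
        have : (u : E) ∈ U' := ⟨u, hu, rfl⟩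
        rw [h, Submodule.mem_bot] at this
        exact hu0 (Subtype.ext this)
    rw [eq_top_iff]
    rintro v -
    have : (v : E) ∈ U' := h1.ge v.2
    obtain ⟨u, hu, huv⟩ := this
    rwa [← Subtype.ext huv]
  intro y
  -- By Schur's lemma over `ℂ` the commutant consists of scalars, so every linear `y` is linear over
  -- it; the density theorem then matches `y` on a finite spanning set.
  let f : Module.End (Module.End A W) W :=
    { toFun := y
      map_add' := map_add y
      map_smul' := fun g v => by
        obtain ⟨c, hc⟩ :=
          (IsSimpleModule.algebraMap_end_bijective_of_isAlgClosed (A := A) (V := W) ℂ).2 g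
        rw [← hc]
        exact map_smul y c v }
  obtain ⟨s, hs⟩ := (inferInstance : Module.Finite ℂ W).fg_top
  obtain ⟨r, hr⟩ := jacobson_density (R := A) f s
  refine ⟨r, ContinuousLinearMap.coe_injective (LinearMap.ext_on hs fun v hv => ?_)⟩
  exact (hr v hv).symm

end InvariantSubspaces

/-! ### The connecting maps between level algebras -/

namespace RootedTree

variable {d : ℕ} [NeZero d] (G : Subgroup (TreeAut d))

/-- The surjection `q` between the level algebras, as a `⋆`-homomorphism. -/
def qHom (n : ℕ) : levelAlgebra G (n + 1) →⋆ₐ[ℂ] levelAlgebra G n where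
  toFun y := ⟨q n y.1, by
    obtain ⟨_, c, hc, rfl⟩ := y
    exact ⟨c, hc, (q_compress n hc).symm⟩⟩
  map_one' := Subtype.ext (by
    change q n 1 = 1
    rw [q, ← Q_adjoint_Q d n]
    rfl)
  map_mul' y z := Subtype.ext (q_mul n y.2 z.2)
  map_zero' := Subtype.ext (by change q n 0 = 0; simp [q])
  map_add' y z := Subtype.ext (q_add _ _)
  commutes' k := Subtype.ext (by
    change q n (algebraMap ℂ _ k) = algebraMap ℂ _ k
    rw [Algebra.algebraMap_eq_smul_one, Algebra.algebraMap_eq_smul_one, ← Q_adjoint_Q d n]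
    ext1 f
    simp [q])
  map_star' y := Subtype.ext (q_star _)

@[simp] theorem coe_qHom (n : ℕ) (y : levelAlgebra G (n + 1)) : (qHom G n y).1 = q n y.1 := rfl

theorem qHom_surjective (n : ℕ) : Function.Surjective (qHom G n) := by
  rintro ⟨_, c, hc, rfl⟩
  exact ⟨⟨compress (n + 1) c, c, hc, rfl⟩, Subtype.ext (q_compress n hc)⟩

end RootedTree

/-- The resolvent of a normal element is bounded by the inverse of the distance to the
spectrum. -/
theorem IsStarNormal.norm_inv_sub_le {A : Type*} [CStarAlgebra A] {y : A} (hy : IsStarNormal y)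
    {μ : ℂ} {u : Aˣ} (hu : u.1 = algebraMap ℂ A μ - y) {δ : ℝ} (hδ : 0 < δ)
    (h : ∀ ν ∈ spectrum ℂ y, δ ≤ ‖μ - ν‖) : ‖(u⁻¹).1‖ ≤ δ⁻¹ := by
  have hz : IsStarNormal u.1 := by
    rw [hu]
    constructor
    rw [star_sub, ← algebraMap_star_comm]
    refine Commute.sub_left (Algebra.commute_algebraMap_left _ _) (Commute.sub_right
      (Algebra.commute_algebraMap_right _ _) hy.star_comm_self)
  have hw : IsStarNormal (u⁻¹).1 := by
    constructor
    have h1 : Commute (star u) u := Units.ext hz.star_comm_self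
    have h2 : Commute (star u⁻¹) u⁻¹ := by
      rw [star_inv]
      exact h1.inv_inv
    exact congrArg Units.val h2.eq
  -- The norm of the normal inverse is its spectral radius, and each `k` in its spectrum is `(μ -
  -- ν)⁻¹` with `ν = μ - k⁻¹` in the spectrum of `y`.
  have h1 := IsStarNormal.spectralRadius_eq_nnnorm (u⁻¹).1
  have h2 : spectralRadius ℂ (u⁻¹).1 ≤ ENNReal.ofReal δ⁻¹ := by
    refine iSup₂_le fun k hk => ?_
    have hk0 : k ≠ 0 := by
      rintro rfl
      exact spectrum.zero_notMem ℂ (u⁻¹).isUnit hk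
    have hk1 : k⁻¹ ∈ spectrum ℂ u.1 := by
      have := spectrum.inv_mem_iff (r := Units.mk0 k hk0) (a := u⁻¹)
      simpa using this.1 hk
    rw [hu, spectrum.mem_iff] at hk1
    have hk2 : μ - k⁻¹ ∈ spectrum ℂ y := by
      rw [spectrum.mem_iff]
      intro hun
      apply hk1
      rw [← IsUnit.neg_iff]
      convert hun using 1
      rw [map_sub]
      abel
    have hk3 := h _ hk2
    rw [sub_sub_cancel, norm_inv] at hk3
    rw [← enorm_eq_nnnorm, ← ofReal_norm]
    exact ENNReal.ofReal_le_ofReal ((le_inv_comm₀ hδ (norm_pos_iff.2 hk0)).1 hk3)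
  rw [h1, ← enorm_eq_nnnorm, ← ofReal_norm, ENNReal.ofReal_le_ofReal_iff (by positivity)] at h2
  exact h2

/-! ### Operators bounded below -/

section BoundedBelow

variable {E : Type*} [NormedAddCommGroup E] [InnerProductSpace ℂ E]

theorem isUnit_of_injective [FiniteDimensional ℂ E] {z : E →L[ℂ] E}
    (hz : Function.Injective z) : IsUnit z := by
  have h : IsUnit (z : E →ₗ[ℂ] E) := (LinearMap.isUnit_iff_ker_eq_bot _).2
    (LinearMap.ker_eq_bot.2 hz)
  obtain ⟨u, hu⟩ := h
  refine ⟨⟨z, LinearMap.toContinuousLinearMap (u⁻¹).1, ?_, ?_⟩, rfl⟩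
  · ext1 v
    have := congrArg (fun f : E →ₗ[ℂ] E => f v) u.mul_inv
    rw [hu] at this
    exact this
  · ext1 v
    have := congrArg (fun f : E →ₗ[ℂ] E => f v) u.inv_mul
    rw [hu] at this
    exact this

theorem injective_of_norm_le {z : E →L[ℂ] E} {K : ℝ} (h : ∀ v, ‖v‖ ≤ K * ‖z v‖) :
    Function.Injective z := by
  rw [injective_iff_map_eq_zero]
  intro v hv
  have := h v
  rw [hv, norm_zero, mul_zero] at this
  exact norm_le_zero_iff.1 this

theorem norm_le_of_mul_eq_one {w z : E →L[ℂ] E} (h : w * z = 1) (v : E) :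
    ‖v‖ ≤ ‖w‖ * ‖z v‖ := by
  have : w (z v) = v := by
    change (w * z) v = v
    rw [h]; rfl
  calc ‖v‖ = ‖w (z v)‖ := by rw [this]
    _ ≤ _ := w.le_opNorm _

theorem norm_le_of_norm_le_mul {w z : E →L[ℂ] E} (h : z * w = 1) {K : ℝ}
    (hz : ∀ v, ‖v‖ ≤ K * ‖z v‖) : ‖w‖ ≤ max K 0 := by
  refine w.opNorm_le_bound (le_max_right _ _) fun v => ?_
  have : z (w v) = v := by
    change (z * w) v = v
    rw [h]; rfl
  calc ‖w v‖ ≤ K * ‖z (w v)‖ := hz _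
    _ ≤ _ := by rw [this]; exact mul_le_mul_of_nonneg_right (le_max_left _ _) (norm_nonneg _)

end BoundedBelow

/-! ### The spectrum in `S(G)` and the normal case -/

namespace RootedTree

variable {d : ℕ}

theorem not_mem_spectrum_level_iff {n : ℕ} (y : LevelOp d n) (μ : ℂ) :
    μ ∉ spectrum ℂ y ↔ Function.Injective fun v => μ • v - y v := by
  rw [spectrum.notMem_iff]
  constructor
  · rintro ⟨u, hu⟩
    refine injective_of_norm_le (z := algebraMap ℂ (LevelOp d n) μ - y) (K := ‖(u⁻¹).1‖) ?_
    rw [← hu]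
    exact norm_le_of_mul_eq_one u.inv_mul
  · intro h
    exact isUnit_of_injective (z := algebraMap ℂ (LevelOp d n) μ - y) h

theorem norm_le_of_isStarNormal {n : ℕ} {y : LevelOp d n} (hy : IsStarNormal y) {μ : ℂ} {δ : ℝ}
    (hδ : 0 < δ) (h : ∀ ν ∈ spectrum ℂ y, δ ≤ ‖μ - ν‖) (v : EllTwoLevel d n) :
    ‖v‖ ≤ δ⁻¹ * ‖μ • v - y v‖ := by
  have hμ : μ ∉ spectrum ℂ y := fun hμ => by
    have := h μ hμ
    rw [sub_self, norm_zero] at this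
    linarith
  obtain ⟨u, hu⟩ := spectrum.notMem_iff.1 hμ
  have h3 := norm_le_of_mul_eq_one u.inv_mul v
  rw [hu] at h3
  exact h3.trans (mul_le_mul_of_nonneg_right (hy.norm_inv_sub_le hu hδ h) (norm_nonneg _))

variable [NeZero d] {G : Subgroup (TreeAut d)}

/-- An element of `S(G)` is invertible if and only if its components are uniformly bounded
below. -/
theorem isUnit_vonNeumann_iff (z : vonNeumann G) :
    IsUnit z ↔ ∃ K : ℝ, ∀ n v, ‖v‖ ≤ K * ‖z.1 n v‖ := by
  constructor
  · rintro ⟨u, rfl⟩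
    obtain ⟨K, hK⟩ := (u⁻¹).1.2.2.2
    refine ⟨K, fun n v => ?_⟩
    have h : (u⁻¹).1.1 n * u.1.1 n = 1 :=
      congrArg (fun y : vonNeumann G => y.1 n) u.inv_mul
    exact (norm_le_of_mul_eq_one h v).trans
      (mul_le_mul_of_nonneg_right (hK n) (norm_nonneg _))
  · rintro ⟨K, hK⟩
    -- Spectral permanence: an operator in `R n` that is invertible has its inverse in `R n`.
    have hu : ∀ n, IsUnit (⟨z.1 n, z.2.1 n⟩ : levelAlgebra G n) := fun n =>
      (StarSubalgebra.coe_isUnit _).1 (isUnit_of_injective (injective_of_norm_le (hK n)))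
    choose u hu using hu
    have hzu : ∀ n, z.1 n * (u n)⁻¹.1.1 = 1 := fun n => by
      have := congrArg Subtype.val (u n).mul_inv
      rw [hu n] at this
      exact this
    have huz : ∀ n, (u n)⁻¹.1.1 * z.1 n = 1 := fun n => by
      have := congrArg Subtype.val (u n).inv_mul
      rw [hu n] at this
      exact this
    let w : vonNeumann G := ⟨fun n => (u n)⁻¹.1.1, fun n => (u n)⁻¹.1.2, fun n => by
      -- Compatibility is automatic: `q` sends the inverse at level `n + 1` to a left inverse of `z
      -- n`, hence to the inverse at level `n`.
      refine left_inv_eq_right_inv ?_ (hzu n)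
      rw [← z.2.2.1 n, ← q_mul n (u (n + 1))⁻¹.1.2 (z.2.1 (n + 1)), huz]
      exact congrArg Subtype.val (map_one (qHom G n)), max K 0, fun n =>
      norm_le_of_norm_le_mul (hzu n) (hK n)⟩
    exact ⟨⟨z, w, Subtype.ext (funext hzu), Subtype.ext (funext huz)⟩, rfl⟩

theorem mem_spectrum_vonNeumann_iff (x : vonNeumann G) (μ : ℂ) :
    μ ∈ spectrum ℂ x ↔ ¬ ∃ K : ℝ, ∀ n v, ‖v‖ ≤ K * ‖μ • v - x.1 n v‖ := by
  rw [spectrum.mem_iff, isUnit_vonNeumann_iff]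
  rfl

/-- The spectra of the components of `x` are contained in the spectrum of `x`, which is closed. -/
theorem closure_spectrum_subset (x : vonNeumann G) :
    closure (⋃ n : ℕ, spectrum ℂ (x.1 n)) ⊆ spectrum ℂ x := by
  intro μ hμ
  rw [mem_spectrum_vonNeumann_iff]
  rintro ⟨K, hK⟩
  have hK1 : 0 < max K 0 + 1 := by positivity
  -- Moving `μ` by less than half the lower bound of `μ - x n` leaves the other half, so `ν - x n`
  -- is still injective.
  obtain ⟨ν, hν, hdist⟩ := Metric.mem_closure_iff.1 hμ (2 * (max K 0 + 1))⁻¹ (by positivity)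
  obtain ⟨n, hn⟩ := Set.mem_iUnion.1 hν
  refine (not_mem_spectrum_level_iff (x.1 n) ν).2 ?_ hn
  refine injective_of_norm_le (z := algebraMap ℂ (LevelOp d n) ν - x.1 n)
    (K := 2 * (max K 0 + 1)) fun v => ?_
  change ‖v‖ ≤ 2 * (max K 0 + 1) * ‖ν • v - x.1 n v‖
  have h1 := hK n v
  have h2 : ‖μ • v - x.1 n v‖ ≤ ‖ν • v - x.1 n v‖ + (2 * (max K 0 + 1))⁻¹ * ‖v‖ := by
    have : μ • v - x.1 n v = (ν • v - x.1 n v) + (μ - ν) • v := by rw [sub_smul]; abel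
    rw [this]
    refine (norm_add_le _ _).trans (add_le_add_right ?_ _)
    rw [norm_smul]
    refine mul_le_mul_of_nonneg_right ?_ (norm_nonneg _)
    rw [← dist_eq_norm]; exact hdist.le
  have h3 : ‖v‖ ≤ (max K 0 + 1) * ‖μ • v - x.1 n v‖ := h1.trans
    (mul_le_mul_of_nonneg_right ((le_max_left K 0).trans (by linarith)) (norm_nonneg _))
  have h4 := h3.trans (mul_le_mul_of_nonneg_left h2 hK1.le)
  have h5 : (max K 0 + 1) * ((2 * (max K 0 + 1))⁻¹ * ‖v‖) = ‖v‖ / 2 := by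
    field_simp
  rw [mul_add, h5] at h4
  linarith

/-- If the resolvents of the components of `x` are uniformly bounded away from their spectra, then
the spectrum of `x` is the closure of the union of the spectra of the components. -/
theorem spectrum_eq_closure_of_bound (x : vonNeumann G)
    (h : ∀ (μ : ℂ) (δ : ℝ), 0 < δ → (∀ n, ∀ ν ∈ spectrum ℂ (x.1 n), δ ≤ ‖μ - ν‖) →
      ∃ K : ℝ, ∀ n v, ‖v‖ ≤ K * ‖μ • v - x.1 n v‖) :
    spectrum ℂ x = closure (⋃ n : ℕ, spectrum ℂ (x.1 n)) := by
  refine Set.Subset.antisymm (fun μ hμ => ?_) (closure_spectrum_subset x)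
  by_contra hμ'
  rw [Metric.mem_closure_iff] at hμ'
  push Not at hμ'
  obtain ⟨δ, hδ, hdist⟩ := hμ'
  refine (mem_spectrum_vonNeumann_iff x μ).1 hμ (h μ δ hδ fun n ν hν => ?_)
  rw [← dist_eq_norm]
  exact hdist ν (Set.mem_iUnion.2 ⟨n, hν⟩)

theorem spectrum_eq_closure_of_isStarNormal (x : vonNeumann G) (hx : IsStarNormal x) :
    spectrum ℂ x = closure (⋃ n : ℕ, spectrum ℂ (x.1 n)) :=
  spectrum_eq_closure_of_bound x fun _ δ hδ h => ⟨δ⁻¹, fun n v =>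
    norm_le_of_isStarNormal ⟨congrArg (fun y : vonNeumann G => y.1 n) hx.star_comm_self⟩ hδ
      (h n) v⟩

end RootedTree

/-! ### Inverse bounds in bounded dimension -/

section AnnihilatingPolynomial

/-- If `∏ (y - μ i)` vanishes, with `‖y‖ ≤ C` and `δ ≤ ‖μ i‖ ≤ C`, then `y` is bounded below by a
constant depending only on `C`, `δ` and the number of factors. -/
theorem exists_norm_le_of_prod_sub (C δ : ℝ) (hC : 0 ≤ C) (hδ : 0 < δ) (n : ℕ) :
    ∃ K : ℝ, 0 ≤ K ∧ ∀ (E : Type) [NormedAddCommGroup E] [NormedSpace ℂ E] (y : E →L[ℂ] E)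
      (l : List ℂ), l.length = n → ‖y‖ ≤ C → (∀ μ ∈ l, δ ≤ ‖μ‖ ∧ ‖μ‖ ≤ C) →
      ∀ v, ‖v‖ ≤ K * (‖y v‖ + ‖(l.map fun μ => y - μ • (1 : E →L[ℂ] E)).prod v‖) := by
  induction n with
  | zero =>
    refine ⟨1, zero_le_one, fun E _ _ y l hl _ _ v => ?_⟩
    obtain rfl := List.length_eq_zero_iff.1 hl
    simp
  | succ n ih =>
    obtain ⟨K, hK0, hK⟩ := ih
    -- The constant comes from `δ‖v‖ ≤ ‖y v‖ + ‖(y - μ) v‖`, where the last term is bounded by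
    -- induction applied to `(y - μ) v`, using `‖y (y - μ) v‖ ≤ 2C‖y v‖`.
    refine ⟨(1 + K * (2 * C + 1)) / δ, by positivity, fun E _ _ y l hl hy hμ v => ?_⟩
    obtain ⟨l', μ, rfl⟩ : ∃ l' μ, l = l' ++ [μ] := by
      have hne : l ≠ [] := by rintro rfl; simp at hl
      exact ⟨l.dropLast, l.getLast hne, (List.dropLast_append_getLast hne).symm⟩
    have h1 := hK E y l' (by simpa using hl) hy (fun ν hν => hμ ν (by simp [hν])) (y v - μ • v)
    obtain ⟨hμδ, hμC⟩ := hμ μ (by simp)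
    have h2 : ‖y (y v - μ • v)‖ ≤ 2 * C * ‖y v‖ := by
      rw [map_sub, map_smul]
      calc ‖y (y v) - μ • y v‖ ≤ ‖y (y v)‖ + ‖μ • y v‖ := norm_sub_le _ _
        _ ≤ C * ‖y v‖ + C * ‖y v‖ := by
          rw [norm_smul]
          gcongr
          exact y.le_of_opNorm_le hy _
        _ = _ := by ring
    have h3 : ((l' ++ [μ]).map fun μ => y - μ • (1 : E →L[ℂ] E)).prod v =
        (l'.map fun μ => y - μ • (1 : E →L[ℂ] E)).prod (y v - μ • v) := by
      simp
    rw [h3]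
    set F := ‖(l'.map fun μ => y - μ • (1 : E →L[ℂ] E)).prod (y v - μ • v)‖
    have h4 : ‖μ • v‖ ≤ ‖y v‖ + ‖y v - μ • v‖ := by
      have : μ • v = y v - (y v - μ • v) := by abel
      calc ‖μ • v‖ = ‖y v - (y v - μ • v)‖ := by rw [← this]
        _ ≤ _ := norm_sub_le _ _
    rw [norm_smul] at h4
    have h5 : δ * ‖v‖ ≤ ‖μ‖ * ‖v‖ := mul_le_mul_of_nonneg_right hμδ (norm_nonneg _)
    have h6 : K * (‖y (y v - μ • v)‖ + F) ≤ K * (2 * C * ‖y v‖ + F) := by gcongr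
    have hF : 0 ≤ F := norm_nonneg _
    have hyv : 0 ≤ ‖y v‖ := norm_nonneg _
    have h7 : K * (2 * C * ‖y v‖ + F) ≤ K * ((2 * C + 1) * (‖y v‖ + F)) := by
      gcongr
      nlinarith [mul_nonneg hC hF]
    rw [div_mul_eq_mul_div, le_div_iff₀ hδ]
    nlinarith

/-- An operator on a space of dimension at most `m` whose norm is at most `C` and whose
eigenvalues are bounded below by `δ` is bounded below by a constant depending on `m`, `C`, `δ`. -/
theorem exists_norm_le_of_finrank_le (m : ℕ) (C δ : ℝ) (hC : 0 ≤ C) (hδ : 0 < δ) :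
    ∃ K : ℝ, 0 ≤ K ∧ ∀ (E : Type) [NormedAddCommGroup E] [NormedSpace ℂ E] [FiniteDimensional ℂ E]
      (y : E →L[ℂ] E), Module.finrank ℂ E ≤ m → ‖y‖ ≤ C →
      (∀ (μ : ℂ) (v : E), y v = μ • v → v ≠ 0 → δ ≤ ‖μ‖) → ∀ v, ‖v‖ ≤ K * ‖y v‖ := by
  choose K hK0 hK using exists_norm_le_of_prod_sub C δ hC hδ
  -- The sum dominates each nonnegative `K n` with `n ≤ m`, so it serves all dimensions at once.
  refine ⟨∑ n ∈ Finset.range (m + 1), K n, Finset.sum_nonneg fun n _ => hK0 n,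
    fun E _ _ _ y hm hy hev v => ?_⟩
  let f : Module.End ℂ E := y
  let l := f.charpoly.roots.toList
  have hsplit : (f.charpoly.roots.map fun a => Polynomial.X - Polynomial.C a).prod = f.charpoly := by
    have h := (IsAlgClosed.splits f.charpoly).eq_prod_roots
    rw [f.charpoly_monic.leadingCoeff, map_one, one_mul] at h
    exact h.symm
  have hlen : l.length = Module.finrank ℂ E := by
    rw [Multiset.length_toList, ← f.charpoly_natDegree]
    exact ((IsAlgClosed.splits f.charpoly).natDegree_eq_card_roots).symm
  have hl : ∀ μ ∈ l, δ ≤ ‖μ‖ ∧ ‖μ‖ ≤ C := by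
    intro μ hμ
    have hμ' := (Polynomial.mem_roots f.charpoly_monic.ne_zero).1 (Multiset.mem_toList.1 hμ)
    obtain ⟨w, hw, hw0⟩ := ((f.hasEigenvalue_iff_isRoot_charpoly μ).2 hμ').exists_hasEigenvector
    have hw' : y w = μ • w := Module.End.mem_eigenspace_iff.1 hw
    refine ⟨hev μ w hw' hw0, ?_⟩
    have h := y.le_of_opNorm_le hy w
    rw [hw', norm_smul] at h
    exact le_of_mul_le_mul_right h (norm_pos_iff.2 hw0)
  -- Cayley–Hamilton, with the characteristic polynomial split over `ℂ`.
  have hprod : (l.map fun μ => y - μ • (1 : E →L[ℂ] E)).prod = 0 := by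
    have h1 := f.aeval_self_charpoly
    rw [← hsplit, ← Multiset.coe_toList f.charpoly.roots, Multiset.map_coe, Multiset.prod_coe,
      map_list_prod, List.map_map] at h1
    apply ContinuousLinearMap.coe_injective
    change ContinuousLinearMap.toLinearMapRingHom _ = 0
    rw [map_list_prod, List.map_map, ← h1]
    congr 2
    funext μ
    simp only [Function.comp_apply, map_sub, Polynomial.aeval_X, Polynomial.aeval_C]
    rfl
  have h := hK _ E y l rfl hy hl v
  rw [hprod] at h
  simp only [zero_apply, norm_zero, add_zero] at h
  refine h.trans (mul_le_mul_of_nonneg_right ?_ (norm_nonneg _))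
  exact Finset.single_le_sum (f := K) (fun n _ => hK0 n) (Finset.mem_range.2 (by omega))

end AnnihilatingPolynomial

/-! ### Virtually abelian groups: the equality holds -/

namespace RootedTree

variable {d : ℕ}

/-- The permutation representation of the automorphism group on `ℓ²` of the `n`-th level. -/
def levelRep (d n : ℕ) : TreeAut d →* LevelOp d n where
  toFun g := compress n (rho d g)
  map_one' := by rw [map_one, ← p_p_adjoint d n]; rfl
  map_mul' g h := by
    ext f v
    simpa [compress, p_adjoint_apply, aut_length] using fun h => absurd v.2 h

theorem levelRep_apply {n : ℕ} (g : TreeAut d) (f : EllTwoLevel d n) (v : Level d n) :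
    levelRep d n g f v = f ⟨g⁻¹ v.1, by rw [aut_length, v.2]⟩ := by
  have h : (g⁻¹ v.1).length = n := by rw [aut_length, v.2]
  change p d n (rho d g ((p d n).adjoint f)) v = _
  rw [p_apply, rho_apply, p_adjoint_apply, dif_pos h]

theorem levelRep_mem {G : Subgroup (TreeAut d)} {g : TreeAut d} (hg : g ∈ G) (n : ℕ) :
    levelRep d n g ∈ levelAlgebra G n := by
  refine ⟨rho d g, ?_, rfl⟩
  refine (groupAlgebraImage G).le_topologicalClosure ?_
  exact ⟨MonoidAlgebra.of ℂ G ⟨g, hg⟩, by simp⟩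

theorem star_levelRep {n : ℕ} (g : TreeAut d) : star (levelRep d n g) = levelRep d n g⁻¹ := by
  change star (compress n (rho d g)) = compress n (rho d g⁻¹)
  rw [← star_rho]
  simp [compress, ContinuousLinearMap.star_eq_adjoint, ContinuousLinearMap.adjoint_comp,
    ContinuousLinearMap.comp_assoc]

/-- A subspace is invariant under the level algebra if and only if it is invariant under the
group. -/
theorem isInvariantUnder_levelAlgebra_iff {G : Subgroup (TreeAut d)} {n : ℕ}
    {W : Submodule ℂ (EllTwoLevel d n)} :
    IsInvariantUnder (levelAlgebra G n : Set (LevelOp d n)) W ↔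
      ∀ g ∈ G, ∀ v ∈ W, levelRep d n g v ∈ W := by
  refine ⟨fun h g hg v hv => h _ (levelRep_mem hg n) v hv, fun h => ?_⟩
  rintro _ ⟨c, hc, rfl⟩ v hv
  let F : (EllTwo d →L[ℂ] EllTwo d) →ₗ[ℂ] EllTwoLevel d n :=
    { toFun := fun c => compress n c v
      map_add' := fun a b => by simp [compress]
      map_smul' := fun k a => by simp [compress] }
  have hF : Continuous F := by
    change Continuous fun c : EllTwo d →L[ℂ] EllTwo d => p d n (c ((p d n).adjoint v))
    fun_prop
  exact fundamentalCStar_induction (G := G) (S := W.comap F)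
    (W.closed_of_finiteDimensional.preimage hF) (fun g hg => h g hg v hv) hc

/-- If `G` has an abelian subgroup of index `m`, then minimal invariant subspaces have dimension
at most `m`. -/
theorem finrank_le_index {G : Subgroup (TreeAut d)} {H : Subgroup G} [H.FiniteIndex]
    (hH : ∀ a ∈ H, ∀ b ∈ H, a * b = b * a) {n : ℕ} {W : Submodule ℂ (EllTwoLevel d n)}
    (hW : IsMinimalInvariant (levelAlgebra G n : Set (LevelOp d n)) W) :
    Module.finrank ℂ W ≤ H.index := by
  let π : G →* LevelOp d n := (levelRep d n).comp G.subtype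
  let T : Set (LevelOp d n) := π '' H
  have hWπ : ∀ g : G, ∀ v ∈ W, π g v ∈ W := fun g =>
    isInvariantUnder_levelAlgebra_iff.1 hW.invariant g g.2
  have hWT : IsInvariantUnder T W := by
    rintro _ ⟨h, -, rfl⟩
    exact hWπ h
  obtain ⟨U, hUW, hU⟩ := hWT.exists_isMinimalInvariant hW.ne_bot
  -- An eigenspace of `π h` in `U` is invariant under the commuting operators of `H`, hence is all
  -- of `U` by minimality.
  have hscalar : ∀ h ∈ H, ∃ c : ℂ, ∀ u ∈ U, π h u = c • u := by
    intro h hh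
    have : Nontrivial U := Submodule.nontrivial_iff_ne_bot.2 hU.ne_bot
    obtain ⟨c, hc⟩ := Module.End.exists_eigenvalue
      ((π h : EllTwoLevel d n →ₗ[ℂ] EllTwoLevel d n).restrict (p := U) (q := U)
        (fun u hu => hU.invariant _ ⟨h, hh, rfl⟩ u hu))
    obtain ⟨w, hw, hw0⟩ := hc.exists_hasEigenvector
    have hw' : π h w = c • (w : EllTwoLevel d n) :=
      congrArg Subtype.val (Module.End.mem_eigenspace_iff.1 hw)
    let U' : Submodule ℂ (EllTwoLevel d n) :=
      U ⊓ LinearMap.ker ((π h - c • 1 : LevelOp d n) : EllTwoLevel d n →ₗ[ℂ] EllTwoLevel d n)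
    have hmem : ∀ u, u ∈ U' ↔ u ∈ U ∧ π h u = c • u := fun u => by
      rw [Submodule.mem_inf, LinearMap.mem_ker, ← sub_eq_zero (b := c • u)]
      rfl
    have hU' : U' = U := by
      refine hU.eq_of_le _ inf_le_left ?_ fun h0 => ?_
      · rintro _ ⟨g, hg, rfl⟩ v hv
        rw [hmem] at hv ⊢
        refine ⟨hU.invariant _ ⟨g, hg, rfl⟩ v hv.1, ?_⟩
        rw [← mul_apply_eq_comp, ← map_mul, hH h hh g hg, map_mul, mul_apply_eq_comp, hv.2,
          map_smul]
      · have : (w : EllTwoLevel d n) ∈ U' := (hmem _).2 ⟨w.2, hw'⟩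
        rw [h0, Submodule.mem_bot] at this
        exact hw0 (Subtype.ext this)
    exact ⟨c, fun u hu => ((hmem u).1 (hU'.ge hu)).2⟩
  obtain ⟨u, huU, hu0⟩ := Submodule.exists_mem_ne_zero_of_ne_bot hU.ne_bot
  have : Fintype (G ⧸ H) := Fintype.ofFinite _
  -- Since `H` acts on `u` by scalars, one translate of `u` for each coset already spans the whole
  -- orbit of `u`, which spans `W`.
  let V : Submodule ℂ (EllTwoLevel d n) := Submodule.span ℂ (Set.range fun x : G ⧸ H => π x.out u)
  have hV : ∀ g : G, π g u ∈ V := by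
    intro g
    obtain ⟨h, hh⟩ := QuotientGroup.mk_out_eq_mul H g
    obtain ⟨c, hc⟩ := hscalar _ (H.inv_mem h.2)
    have : g = (g : G ⧸ H).out * (h : G)⁻¹ := by rw [hh]; group
    rw [this, map_mul, mul_apply_eq_comp, hc u huU, map_smul]
    exact V.smul_mem _ (Submodule.subset_span ⟨_, rfl⟩)
  have hVW : V = W := by
    refine hW.eq_of_le V (Submodule.span_le.2 ?_) ?_ fun h0 => ?_
    · rintro _ ⟨x, rfl⟩
      exact hWπ _ _ (hUW huU)
    · refine isInvariantUnder_levelAlgebra_iff.2 fun g hg v hv => ?_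
      induction hv using Submodule.span_induction with
      | mem v hv =>
        obtain ⟨x, rfl⟩ := hv
        have := hV (⟨g, hg⟩ * x.out)
        rwa [map_mul] at this
      | zero => rw [map_zero]; exact V.zero_mem
      | add a b _ _ ha hb => rw [map_add]; exact V.add_mem ha hb
      | smul c a _ ha => rw [map_smul]; exact V.smul_mem c ha
    · have := hV 1
      rw [h0, Submodule.mem_bot, map_one] at this
      exact hu0 this
  rw [← hVW, Subgroup.index_eq_card, Nat.card_eq_fintype_card]
  exact finrank_range_le_card _

/-- If all minimal invariant subspaces of all levels have dimension at most `m`, then the spectrum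
of each element of `S(G)` is determined by the spectra of its components. -/
theorem spectrum_eq_closure_of_finrank_le [NeZero d] {G : Subgroup (TreeAut d)} {m : ℕ}
    (hm : ∀ n (W : Submodule ℂ (EllTwoLevel d n)),
      IsMinimalInvariant (levelAlgebra G n : Set (LevelOp d n)) W → Module.finrank ℂ W ≤ m)
    (x : vonNeumann G) : spectrum ℂ x = closure (⋃ n : ℕ, spectrum ℂ (x.1 n)) := by
  refine spectrum_eq_closure_of_bound x fun μ δ hδ hμ => ?_
  obtain ⟨C, hC⟩ := x.2.2.2
  have hC' : ∀ n, ‖algebraMap ℂ (LevelOp d n) μ - x.1 n‖ ≤ ‖μ‖ + |C| := fun n =>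
    (norm_sub_le _ _).trans (add_le_add (norm_algebraMap' _ _).le ((hC n).trans (le_abs_self C)))
  obtain ⟨K, hK0, hK⟩ := exists_norm_le_of_finrank_le m (‖μ‖ + |C|) δ (by positivity) hδ
  refine ⟨K, fun n => ?_⟩
  let z : levelAlgebra G n := ⟨algebraMap ℂ (LevelOp d n) μ - x.1 n,
    sub_mem (algebraMap_mem _ _) (x.2.1 n)⟩
  have hz : ∀ v, z.1 v = μ • v - x.1 n v := fun _ => rfl
  suffices h : ∀ v ∈ (⊤ : Submodule ℂ (EllTwoLevel d n)), ‖v‖ ≤ K * ‖z.1 v‖ from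
    fun v => h v trivial
  -- The orthogonal pieces are preserved by `z`, so by Pythagoras a constant valid on each piece is
  -- valid on the whole level.
  refine IsInvariantUnder.induction (T := (levelAlgebra G n : Set (LevelOp d n)))
    (P := fun V => IsInvariantUnder (levelAlgebra G n : Set (LevelOp d n)) V →
      ∀ v ∈ V, ‖v‖ ≤ K * ‖z.1 v‖) (fun a ha => star_mem ha) ?_ ?_ (fun _ _ _ _ => trivial)
      (fun _ _ _ _ => trivial)
  · rintro - v hv
    rw [(Submodule.mem_bot ℂ).1 hv]
    simp
  · intro V U hU hUV ih hV v hv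
    have hUo := hU.invariant.orthogonal fun a ha => star_mem ha
    have ih' := ih fun a ha v hv => ⟨hUo a ha v hv.1, hV a ha v hv.2⟩
    obtain ⟨u, hu, w, hw, rfl⟩ := U.exists_add_mem_mem_orthogonal v
    have hwV : w ∈ V := by
      have := V.sub_mem hv (hUV hu)
      rwa [add_sub_cancel_left] at this
    have h1 : ‖u‖ ≤ K * ‖z.1 u‖ := by
      refine hK U (restrictHom (levelAlgebra G n) hU.invariant z) (hm n U hU) ?_ ?_ ⟨u, hu⟩
      · refine ContinuousLinearMap.opNorm_le_bound _ (by positivity) fun v => ?_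
        exact z.1.le_of_opNorm_le (hC' n) v
      · intro ν v hv hv0
        have hv' : z.1 v = ν • (v : EllTwoLevel d n) := congrArg Subtype.val hv
        have := hμ n (μ - ν) ?_
        · rwa [sub_sub_cancel] at this
        by_contra hν
        have hinj := (not_mem_spectrum_level_iff _ _).1 hν
        refine hv0 (Subtype.ext (hinj ?_))
        rw [hz, sub_eq_iff_eq_add] at hv'
        change (μ - ν) • (v : EllTwoLevel d n) - x.1 n v = _
        rw [sub_smul, hv']
        simp
    have h2 := ih' w ⟨hw, hwV⟩
    have hp : ‖u + w‖ * ‖u + w‖ = ‖u‖ * ‖u‖ + ‖w‖ * ‖w‖ :=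
      norm_add_sq_eq_norm_sq_add_norm_sq_of_inner_eq_zero _ _ (hw u hu)
    have hp' : ‖z.1 (u + w)‖ * ‖z.1 (u + w)‖ = ‖z.1 u‖ * ‖z.1 u‖ + ‖z.1 w‖ * ‖z.1 w‖ := by
      rw [map_add]
      exact norm_add_sq_eq_norm_sq_add_norm_sq_of_inner_eq_zero _ _
        (hUo z.1 z.2 w hw _ (hU.invariant z.1 z.2 u hu))
    refine abs_le_of_sq_le_sq' ?_ (by positivity) |>.2
    have h1' := mul_self_le_mul_self (norm_nonneg u) h1
    have h2' := mul_self_le_mul_self (norm_nonneg w) h2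
    rw [mul_mul_mul_comm] at h1' h2'
    rw [sq, sq, hp, mul_mul_mul_comm, hp', mul_add]
    exact add_le_add h1' h2'

theorem spectrum_eq_closure_of_isVirtuallyAbelian [NeZero d] {G : Subgroup (TreeAut d)}
    (hG : IsVirtuallyAbelian G) (x : vonNeumann G) :
    spectrum ℂ x = closure (⋃ n : ℕ, spectrum ℂ (x.1 n)) := by
  obtain ⟨H, hfin, hH⟩ := hG
  exact spectrum_eq_closure_of_finrank_le (fun n W hW => finrank_le_index hH hW) x

end RootedTree

/-! ### Shifts and nilpotent contractions -/

section Shift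

/-- The shift operator on `ℂ ^ (k + 1)`. -/
def shift (k : ℕ) : EuclideanSpace ℂ (Fin (k + 1)) →L[ℂ] EuclideanSpace ℂ (Fin (k + 1)) :=
  LinearMap.mkContinuous
    { toFun := fun f => WithLp.toLp 2 (Fin.cons 0 fun i : Fin k => f i.castSucc)
      map_add' := fun f g => by
        ext i
        refine Fin.cases ?_ (fun i => ?_) i <;> simp
      map_smul' := fun c f => by
        ext i
        refine Fin.cases ?_ (fun i => ?_) i <;> simp } 1 (fun f => by
    rw [one_mul]
    refine (sq_le_sq₀ (norm_nonneg _) (norm_nonneg _)).1 ?_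
    rw [EuclideanSpace.norm_sq_eq, EuclideanSpace.norm_sq_eq, Fin.sum_univ_succ,
      Fin.sum_univ_castSucc]
    simp)

theorem shift_apply_zero {k : ℕ} (f : EuclideanSpace ℂ (Fin (k + 1))) : shift k f 0 = 0 := rfl

theorem shift_apply_succ {k : ℕ} (f : EuclideanSpace ℂ (Fin (k + 1))) (i : Fin k) :
    shift k f i.succ = f i.castSucc := rfl

theorem norm_shift_le (k : ℕ) : ‖shift k‖ ≤ 1 := LinearMap.mkContinuous_norm_le _ zero_le_one _

theorem isNilpotent_shift (k : ℕ) : IsNilpotent (shift k) := by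
  have h : ∀ (j : ℕ) (f : EuclideanSpace ℂ (Fin (k + 1))) (i : Fin (k + 1)), i.1 < j →
      (shift k ^ j) f i = 0 := by
    intro j
    induction j with
    | zero => intro f i hi; omega
    | succ j ih =>
      intro f i
      rw [pow_succ']
      refine Fin.cases (fun _ => rfl) (fun i hi => ?_) i
      exact ih f i.castSucc (by simpa using hi)
  refine ⟨k + 1, ?_⟩
  ext f i
  exact h _ f i i.2

/-- A vector of norm `√(k + 1)` goes to a unit vector, so `(1 - shift k)⁻¹` grows with the dimension
although the shift is a nilpotent contraction. -/
theorem sub_shift_ones (k : ℕ) :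
    WithLp.toLp 2 (fun _ => 1) - shift k (WithLp.toLp 2 fun _ => 1) =
      EuclideanSpace.single 0 1 := by
  ext i
  refine Fin.cases ?_ (fun i => ?_) i
  · simp [shift_apply_zero]
  · simp [shift_apply_succ]

end Shift

section NilpotentContractions

variable {E : Type*} [NormedAddCommGroup E] [InnerProductSpace ℂ E] [FiniteDimensional ℂ E]

theorem exists_nilpotent_contraction (hE : 0 < Module.finrank ℂ E) :
    ∃ y : E →L[ℂ] E, IsNilpotent y ∧ ‖y‖ ≤ 1 ∧
      ∃ w : E, ‖w - y w‖ = 1 ∧ ‖w‖ ^ 2 = Module.finrank ℂ E := by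
  obtain ⟨k, hk⟩ := Nat.exists_eq_succ_of_ne_zero hE.ne'
  let e : E ≃ₗᵢ[ℂ] EuclideanSpace ℂ (Fin (k + 1)) :=
    ((stdOrthonormalBasis ℂ E).reindex (finCongr hk)).repr
  let y : E →L[ℂ] E := e.symm.toContinuousLinearEquiv.toContinuousLinearMap ∘L shift k ∘L
    e.toContinuousLinearEquiv.toContinuousLinearMap
  have hy : ∀ v, y v = e.symm (shift k (e v)) := fun _ => rfl
  refine ⟨y, ?_, ?_, e.symm (WithLp.toLp 2 fun _ => 1), ?_, ?_⟩
  · obtain ⟨j, hj⟩ := isNilpotent_shift k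
    refine ⟨j, ?_⟩
    have h : ∀ (j : ℕ) v, (y ^ j) v = e.symm ((shift k ^ j) (e v)) := by
      intro j
      induction j with
      | zero => intro v; simp
      | succ j ih => intro v; rw [pow_succ, pow_succ, mul_apply_eq_comp, ih, hy]; simp
    ext v
    rw [h, hj]
    simp
  · refine ContinuousLinearMap.opNorm_le_bound _ zero_le_one fun v => ?_
    rw [hy, e.symm.norm_map, ← e.norm_map v]
    exact (shift k).le_of_opNorm_le (norm_shift_le k) _
  · rw [hy, e.apply_symm_apply, ← map_sub, e.symm.norm_map, sub_shift_ones]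
    simp
  · rw [e.symm.norm_map, EuclideanSpace.norm_sq_eq, hk]
    simp

variable [CompleteSpace E]

/-- If `1 - a` is uniformly bounded below for all nilpotent contractions `a` in a `⋆`-algebra of
operators, then the dimensions of the minimal invariant subspaces are bounded. -/
theorem IsMinimalInvariant.finrank_le_sq {A : StarSubalgebra ℂ (E →L[ℂ] E)} {W : Submodule ℂ E}
    (hW : IsMinimalInvariant (A : Set (E →L[ℂ] E)) W) {N : ℝ}
    (hN : ∀ a : A, IsNilpotent a → ‖a‖ ≤ 1 → ∀ v, ‖v‖ ≤ N * ‖v - a.1 v‖) :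
    (Module.finrank ℂ W : ℝ) ≤ N ^ 2 := by
  -- Burnside's theorem makes restriction to `W` surjective; its section lifts the shift on `W` to a
  -- nilpotent contraction in `A` acting on `W` as the shift.
  obtain ⟨s, -, -, -, -, -, -, -, hs⟩ :=
    StarAlgHom.exists_section (A := A) (B := W →L[ℂ] W) (restrictHom A hW.invariant)
      (restrictHom_surjective A hW)
  have hpos : 0 < Module.finrank ℂ W := by
    have := Submodule.nontrivial_iff_ne_bot.2 hW.ne_bot
    exact Module.finrank_pos
  obtain ⟨y, ⟨j, hj⟩, hy1, w, hw1, hw2⟩ := exists_nilpotent_contraction hpos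
  -- The section is not unital, so only positive powers are preserved.
  have hpow : ∀ i, s (y ^ (i + 1)) = s y ^ (i + 1) := by
    intro i
    induction i with
    | zero => simp
    | succ i ih => rw [pow_succ, map_mul, ih, ← pow_succ]
  have hnil : IsNilpotent (s y) := ⟨j + 1, by rw [← hpow, pow_succ, hj, zero_mul, map_zero]⟩
  have h := hN (s y) hnil ((NonUnitalStarAlgHom.norm_apply_le s y).trans hy1) w
  have hsw : (s y).1 w = y w := by
    rw [← coe_restrictHom_apply A hW.invariant, hs]
  rw [hsw] at h
  have h' : ‖w‖ ≤ N * ‖w - y w‖ := h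
  rw [hw1, mul_one] at h'
  rw [← hw2]
  exact pow_le_pow_left₀ (norm_nonneg _) h' 2

end NilpotentContractions

/-! ### Operators that are block diagonal for a projection -/

section Projections

variable {E : Type*} [NormedAddCommGroup E] [InnerProductSpace ℂ E] [CompleteSpace E]

theorem norm_sq_eq_of_projection {e : E →L[ℂ] E} (he : IsSelfAdjoint e) (hee : e * e = e) (v : E) :
    ‖v‖ ^ 2 = ‖e v‖ ^ 2 + ‖v - e v‖ ^ 2 := by
  have h0 : inner ℂ (e v) (v - e v) = 0 := by
    rw [← ContinuousLinearMap.adjoint_inner_right, ← ContinuousLinearMap.star_eq_adjoint,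
      he.star_eq, map_sub, ← mul_apply_eq_comp, hee, sub_self, inner_zero_right]
  have h := norm_add_sq_eq_norm_sq_add_norm_sq_of_inner_eq_zero _ _ h0
  rw [add_sub_cancel] at h
  simpa only [sq] using h

theorem norm_projection_le {e : E →L[ℂ] E} (he : IsSelfAdjoint e) (hee : e * e = e) : ‖e‖ ≤ 1 := by
  refine ContinuousLinearMap.opNorm_le_bound _ zero_le_one fun v => ?_
  rw [one_mul]
  refine (sq_le_sq₀ (norm_nonneg _) (norm_nonneg _)).1 ?_
  have := norm_sq_eq_of_projection he hee v
  nlinarith [sq_nonneg ‖v - e v‖]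

/-- The operator `a` lives on the kernel of `e` and `b` on its range; the two are orthogonal, so
Pythagoras applies. -/
theorem norm_add_le_of_projection {e a b : E →L[ℂ] E} (he : IsSelfAdjoint e) (hee : e * e = e)
    (hea : e * a = 0) (hae : a * e = 0) (heb : e * b = b) (hbe : b * e = b) (ha : ‖a‖ ≤ 1)
    (hb : ‖b‖ ≤ 1) : ‖a + b‖ ≤ 1 := by
  refine ContinuousLinearMap.opNorm_le_bound _ zero_le_one fun v => ?_
  rw [one_mul]
  refine (sq_le_sq₀ (norm_nonneg _) (norm_nonneg _)).1 ?_
  have h1 : e ((a + b) v) = b (e v) := by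
    rw [← mul_apply_eq_comp, ← mul_apply_eq_comp, mul_add, hea, zero_add, heb, hbe]
  have h2 : (a + b) v - e ((a + b) v) = a (v - e v) := by
    rw [h1, map_sub, ← mul_apply_eq_comp, ← mul_apply_eq_comp, hae, hbe]
    simp
  rw [norm_sq_eq_of_projection he hee ((a + b) v), norm_sq_eq_of_projection he hee v, h2, h1]
  have h3 := b.le_of_opNorm_le hb (e v)
  have h4 := a.le_of_opNorm_le ha (v - e v)
  rw [one_mul] at h3 h4
  gcongr

/-- To bound `1 - a` below, it suffices to do so on the range and on the kernel of a projection
commuting with `a`. -/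
theorem norm_le_of_projection {e a : E →L[ℂ] E} (he : IsSelfAdjoint e) (hee : e * e = e)
    (hea : e * a = a * e) {N : ℝ} (hN : 0 ≤ N) (h1 : ∀ v, e v = v → ‖v‖ ≤ N * ‖v - a v‖)
    (h0 : ∀ v, e v = 0 → ‖v‖ ≤ N * ‖v - a v‖) (v : E) : ‖v‖ ≤ N * ‖v - a v‖ := by
  have hee' : ∀ v, e (e v) = e v := fun v => by rw [← mul_apply_eq_comp, hee]
  have hea' : e (a v) = a (e v) := by rw [← mul_apply_eq_comp, hea, mul_apply_eq_comp]
  have h2 := h1 (e v) (hee' v)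
  have h3 := h0 (v - e v) (by rw [map_sub, hee', sub_self])
  refine (sq_le_sq₀ (norm_nonneg _) (by positivity)).1 ?_
  have h4 : v - e v - a (v - e v) = v - a v - e (v - a v) := by
    rw [map_sub, map_sub, hea']; abel
  have h5 : e v - a (e v) = e (v - a v) := by rw [map_sub, hea']
  rw [h4] at h3
  rw [h5] at h2
  rw [mul_pow, norm_sq_eq_of_projection he hee v, norm_sq_eq_of_projection he hee (v - a v),
    mul_add, ← mul_pow, ← mul_pow]
  gcongr

end Projections

/-! ### Lifting nilpotent contractions and their bounds -/

section NilpotentContractions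

variable {E : Type*} [NormedAddCommGroup E] [InnerProductSpace ℂ E] [FiniteDimensional ℂ E]

/-- The inverse of `1 - a` is a geometric sum of `dim E` contractions. This crude bound serves the
base level and shows that the supremum over nilpotent contractions of a fixed level is finite. -/
theorem norm_le_of_isNilpotent {a : E →L[ℂ] E} (ha : IsNilpotent a) (ha1 : ‖a‖ ≤ 1) (v : E) :
    ‖v‖ ≤ Module.finrank ℂ E * ‖v - a v‖ := by
  set D := Module.finrank ℂ E
  have hD : a ^ D = 0 := by
    have h : IsNilpotent (a : Module.End ℂ E) := ha.map ContinuousLinearMap.toLinearMapRingHom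
    have h1 := (a : Module.End ℂ E).aeval_self_charpoly
    rw [h.charpoly_eq_X_pow_finrank, map_pow, Polynomial.aeval_X] at h1
    apply ContinuousLinearMap.coe_injective
    change ContinuousLinearMap.toLinearMapRingHom (a ^ D) = 0
    rw [map_pow]
    exact h1
  have h1 : (∑ i ∈ Finset.range D, a ^ i) * (1 - a) = 1 := by
    rw [geom_sum_mul_neg, hD, sub_zero]
  refine (norm_le_of_mul_eq_one h1 v).trans (mul_le_mul_of_nonneg_right ?_ (norm_nonneg _))
  have h2 : ∀ i, ‖a ^ i‖ ≤ 1 := by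
    intro i
    refine ContinuousLinearMap.opNorm_le_bound _ zero_le_one ?_
    induction i with
    | zero => intro v; simp
    | succ i ih =>
      intro v
      rw [pow_succ']
      refine (a.le_of_opNorm_le ha1 _).trans ?_
      rw [one_mul]
      exact ih v
  calc ‖∑ i ∈ Finset.range D, a ^ i‖ ≤ ∑ i ∈ Finset.range D, ‖a ^ i‖ := norm_sum_le _ _
    _ ≤ ∑ i ∈ Finset.range D, 1 := Finset.sum_le_sum fun i _ => h2 i
    _ = D := by simp

theorem exists_inverse_of_isNilpotent {A : StarSubalgebra ℂ (E →L[ℂ] E)} {a : A}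
    (ha : IsNilpotent a) {N : ℝ} (hN : 0 ≤ N) (h : ∀ v, ‖v‖ ≤ N * ‖v - a.1 v‖) :
    ∃ c : A, c * (1 - a) = 1 ∧ ‖c‖ ≤ N := by
  obtain ⟨u, hu⟩ := ha.isUnit_one_sub
  have h1 := u.inv_mul
  have h2 := u.mul_inv
  rw [hu] at h1 h2
  refine ⟨(u⁻¹).1, h1, ?_⟩
  exact (norm_le_of_norm_le_mul (congrArg Subtype.val h2) h).trans (max_le le_rfl hN)

variable [CompleteSpace E] {F : Type*} [NormedAddCommGroup F] [InnerProductSpace ℂ F]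
  [FiniteDimensional ℂ F] [CompleteSpace F]
  {A : StarSubalgebra ℂ (E →L[ℂ] E)} {B : StarSubalgebra ℂ (F →L[ℂ] F)}

/-- A uniform lower bound for `1 - a`, for nilpotent contractions `a`, lifts along a surjective
`⋆`-homomorphism if it holds on the kernel. -/
theorem StarAlgHom.nilpotent_bound_of_surjective (φ : A →⋆ₐ[ℂ] B) (hφ : Function.Surjective φ)
    {N : ℝ} (hN : 0 ≤ N)
    (hker : ∀ y : A, φ y = 0 → IsNilpotent y → ‖y‖ ≤ 1 → ∀ v, ‖v‖ ≤ N * ‖v - y.1 v‖)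
    (hB : ∀ b : B, IsNilpotent b → ‖b‖ ≤ 1 → ∀ v, ‖v‖ ≤ N * ‖v - b.1 v‖)
    (a : A) (ha : IsNilpotent a) (ha1 : ‖a‖ ≤ 1) (v : E) : ‖v‖ ≤ N * ‖v - a.1 v‖ := by
  obtain ⟨s, e, he, hee, hφe, -, hcomm, hs, -⟩ :=
    StarAlgHom.exists_section (A := A) (B := B) φ hφ
  have he' : IsSelfAdjoint e.1 := congrArg Subtype.val he
  have hee' : e.1 * e.1 = e.1 := congrArg Subtype.val hee
  have hea : e.1 * a.1 = a.1 * e.1 := congrArg Subtype.val (hcomm a)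
  -- On the range of `e`, `a` acts as `e * a`, which lies in the kernel of `φ`; on the kernel of
  -- `e`, an inverse of `1 - a` is the image under `s` of one for `1 - φ a`.
  refine norm_le_of_projection he' hee' hea hN (fun v hv => ?_) (fun v hv => ?_) v
  · have h := hker (e * a) (by rw [map_mul, hφe, zero_mul])
      (Commute.isNilpotent_mul_left (hcomm a) ha) ?_ v
    · have h1 : (e * a).1 v = a.1 v := by
        change (e.1 * a.1) v = _
        rw [hea, mul_apply_eq_comp, hv]
      rwa [h1] at h
    · refine (norm_mul_le e a).trans (mul_le_one₀ (norm_projection_le he' hee') (norm_nonneg _) ha1)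
  · obtain ⟨c, hc, hcN⟩ := exists_inverse_of_isNilpotent (ha.map φ) hN
      (hB (φ a) (ha.map φ) ((NonUnitalStarAlgHom.norm_apply_le φ a).trans ha1))
    have h1 : s c * (1 - a) * (1 - e) = 1 - e := by
      have h2 : s 1 = 1 - e := by rw [← map_one φ, hs, mul_one]
      have h3 : s c = s c * (1 - e) := by rw [← h2, ← map_mul, mul_one]
      have h4 : s (1 - φ a) = (1 - e) * (1 - a) := by rw [← map_one φ, ← map_sub, hs]
      have h5 : s c * (1 - a) = 1 - e := by
        rw [h3, mul_assoc, ← h4, ← map_mul, hc, h2]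
      simp [h5, mul_sub, sub_mul, hee]
    have h2 : (s c).1 (v - a.1 v) = v := by
      have := congrArg (fun T : A => T.1 v) h1
      change (s c).1 ((v - e.1 v) - a.1 (v - e.1 v)) = v - e.1 v at this
      rwa [hv, sub_zero] at this
    calc ‖v‖ = ‖(s c).1 (v - a.1 v)‖ := by rw [h2]
      _ ≤ N * _ := (s c).1.le_of_opNorm_le ((NonUnitalStarAlgHom.norm_apply_le s c).trans hcN) _

/-- Along a surjective `⋆`-homomorphism `φ`, a nilpotent contraction lifts to a nilpotent
contraction `a` such that a lower bound for `1 - a` entails one for all nilpotent contractions in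
the kernel of `φ`. -/
theorem StarAlgHom.exists_nilpotent_lift (φ : A →⋆ₐ[ℂ] B) (hφ : Function.Surjective φ)
    (b : B) (hb : IsNilpotent b) (hb1 : ‖b‖ ≤ 1) :
    ∃ a : A, φ a = b ∧ IsNilpotent a ∧ ‖a‖ ≤ 1 ∧ ∀ K : ℝ, (∀ v, ‖v‖ ≤ K * ‖v - a.1 v‖) →
      ∀ y : A, φ y = 0 → IsNilpotent y → ‖y‖ ≤ 1 →
        ∀ v, ‖v‖ ≤ (max K 1 + 1) * ‖v - y.1 v‖ := by
  obtain ⟨s, e, he, hee, hφe, hunit, hcomm, hs, hφs⟩ :=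
    StarAlgHom.exists_section (A := A) (B := B) φ hφ
  have he' : IsSelfAdjoint e.1 := congrArg Subtype.val he
  have hee' : e.1 * e.1 = e.1 := congrArg Subtype.val hee
  let c : A → ℝ := fun y => ‖Ring.inverse (1 - y)‖
  have hinv : ∀ y : A, IsNilpotent y → Ring.inverse (1 - y) * (1 - y) = 1 := fun y hy =>
    Ring.inverse_mul_cancel _ hy.isUnit_one_sub
  have hinv' : ∀ y : A, IsNilpotent y → (1 - y) * Ring.inverse (1 - y) = 1 := fun y hy =>
    Ring.mul_inverse_cancel _ hy.isUnit_one_sub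
  have hc : ∀ (y : A) (N : ℝ), IsNilpotent y → (∀ v, ‖v‖ ≤ N * ‖v - y.1 v‖) → c y ≤ max N 0 :=
    fun y N hy hN => norm_le_of_norm_le_mul (congrArg Subtype.val (hinv' y hy)) hN
  have hc' : ∀ y : A, IsNilpotent y → ∀ v, ‖v‖ ≤ c y * ‖v - y.1 v‖ := fun y hy =>
    norm_le_of_mul_eq_one (congrArg Subtype.val (hinv y hy))
  -- A nearly worst nilpotent contraction in the kernel; allowing an error of `1` avoids showing
  -- that the supremum is attained.
  obtain ⟨y, ⟨hφy, hy, hy1⟩, hmax⟩ : ∃ y : A, (φ y = 0 ∧ IsNilpotent y ∧ ‖y‖ ≤ 1) ∧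
      ∀ z : A, φ z = 0 → IsNilpotent z → ‖z‖ ≤ 1 → c z ≤ c y + 1 := by
    let Y : Set A := {y | φ y = 0 ∧ IsNilpotent y ∧ ‖y‖ ≤ 1}
    have hY : (c '' Y).Nonempty := ⟨_, 0, ⟨map_zero φ, IsNilpotent.zero, by simp⟩, rfl⟩
    have hbdd : BddAbove (c '' Y) := by
      refine ⟨max (Module.finrank ℂ E) 0, ?_⟩
      rintro _ ⟨y, hy, rfl⟩
      exact hc y _ hy.2.1 (norm_le_of_isNilpotent (hy.2.1.map A.subtype) hy.2.2)
    obtain ⟨_, ⟨y, hy, rfl⟩, hlt⟩ := exists_lt_of_lt_csSup hY (sub_one_lt (sSup (c '' Y)))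
    refine ⟨y, hy, fun z h1 h2 h3 => ?_⟩
    have := le_csSup hbdd ⟨z, ⟨h1, h2, h3⟩, rfl⟩
    linarith
  have hes : e * s b = 0 := by
    rw [← hφs b, hs, ← mul_assoc, mul_sub, mul_one, hee, sub_self, zero_mul]
  have hse : s b * e = 0 := by rw [← hcomm, hes]
  have hey : e * y = y := hunit y hφy
  have hye : y * e = y := by rw [← hcomm, hey]
  have hsy : s b * y = 0 := by rw [← hey, ← mul_assoc, hse, zero_mul]
  have hys : y * s b = 0 := by rw [← hye, mul_assoc, hes, mul_zero]
  have hsnil : IsNilpotent (s b) := by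
    obtain ⟨k, hk⟩ := hb
    have hpow : ∀ i, s (b ^ (i + 1)) = s b ^ (i + 1) := by
      intro i
      induction i with
      | zero => simp
      | succ i ih => rw [pow_succ, map_mul, ih, ← pow_succ]
    exact ⟨k + 1, by rw [← hpow, pow_succ, hk, zero_mul, map_zero]⟩
  -- The two summands annihilate each other, so nilpotency and the norm bound can be read off from
  -- each one.
  refine ⟨s b + y, ?_, ?_, ?_, fun K hK z hφz hz hz1 v => ?_⟩
  · rw [map_add, hφs, hφy, add_zero]
  · exact Commute.isNilpotent_add (hsy.trans hys.symm) hsnil hy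
  · exact norm_add_le_of_projection he' hee' (congrArg Subtype.val hes)
      (congrArg Subtype.val hse) (congrArg Subtype.val hey) (congrArg Subtype.val hye)
      ((NonUnitalStarAlgHom.norm_apply_le s b).trans hb1) hy1
  · have hyK : ∀ v, ‖v‖ ≤ max K 1 * ‖v - y.1 v‖ := by
      refine norm_le_of_projection he' hee' (congrArg Subtype.val (hcomm y)) (by positivity)
        (fun v hv => ?_) (fun v hv => ?_)
      · have h1 : (s b + y).1 v = y.1 v := by
          change (s b).1 v + y.1 v = y.1 v
          have : (s b).1 v = 0 := by
            have := congrArg (fun T : A => T.1 v) hse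
            change (s b).1 (e.1 v) = 0 at this
            rwa [hv] at this
          rw [this, zero_add]
        have h2 := hK v
        rw [h1] at h2
        exact h2.trans (mul_le_mul_of_nonneg_right (le_max_left _ _) (norm_nonneg _))
      · have h1 : y.1 v = 0 := by
          have := congrArg (fun T : A => T.1 v) hye
          change y.1 (e.1 v) = y.1 v at this
          rw [← this, hv, map_zero]
        rw [h1, sub_zero]
        exact le_mul_of_one_le_left (norm_nonneg _) (le_max_right _ _)
    have h1 : c y ≤ max K 1 := by
      refine (hc y _ hy hyK).trans (max_le le_rfl (zero_le_one.trans (le_max_right _ _)))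
    refine (hc' z hz v).trans (mul_le_mul_of_nonneg_right ?_ (norm_nonneg _))
    linarith [hmax z hφz hz hz1]

end NilpotentContractions

/-! ### The equality forces bounded irreducible dimensions -/

namespace RootedTree

variable {d : ℕ} [NeZero d] {G : Subgroup (TreeAut d)}

/-- Iterating the nearly worst lifts gives one element of `S(G)` whose component spectra lie in
`{0}`. The hypothesis makes `1` minus it invertible; its lower bound controls the kernel of each
`q`, and induction on the level then reaches all nilpotent contractions. -/
theorem exists_nilpotent_bound
    (h : ∀ x : vonNeumann G, spectrum ℂ x = closure (⋃ n : ℕ, spectrum ℂ (x.1 n))) :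
    ∃ N : ℝ, ∀ n (a : levelAlgebra G n), IsNilpotent a → ‖a‖ ≤ 1 →
      ∀ v, ‖v‖ ≤ N * ‖v - a.1 v‖ := by
  let X : ℕ → Type := fun n => {a : levelAlgebra G n // IsNilpotent a ∧ ‖a‖ ≤ 1}
  choose f hfφ hfnil hf1 hf using fun n (b : X n) =>
    (qHom G n).exists_nilpotent_lift (qHom_surjective G n) b.1 b.2.1 b.2.2
  let x : ∀ n, X n := fun n => Nat.rec (motive := X) ⟨0, IsNilpotent.zero, by simp⟩
    (fun n b => ⟨f n b, hfnil n b, hf1 n b⟩) n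
  let y : vonNeumann G := ⟨fun n => (x n).1.1, fun n => (x n).1.2, fun n =>
    congrArg Subtype.val (hfφ n (x n)), 1, fun n => (x n).2.2⟩
  have hy : (1 : ℂ) ∉ spectrum ℂ y := by
    rw [h]
    intro h1
    have hsub : (⋃ n : ℕ, spectrum ℂ (y.1 n)) ⊆ {0} := by
      refine Set.iUnion_subset fun n μ hμ => ?_
      by_contra hμ0
      refine hμ ?_
      have hnil : IsNilpotent (y.1 n) := (x n).2.1.map (levelAlgebra G n).subtype
      have hcomm : Commute (-(y.1 n)) (algebraMap ℂ (LevelOp d n) μ) :=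
        (Algebra.commute_algebraMap_right _ _)
      have := hnil.neg.isUnit_add_left_of_commute
        ((IsUnit.mk0 μ hμ0).map (algebraMap ℂ (LevelOp d n))) hcomm
      rwa [← sub_eq_add_neg] at this
    have := closure_minimal hsub isClosed_singleton h1
    exact one_ne_zero this
  rw [mem_spectrum_vonNeumann_iff, not_not] at hy
  obtain ⟨K, hK⟩ := hy
  let D : ℝ := Module.finrank ℂ (EllTwoLevel d 0)
  -- The term `max K 1 + 1` handles the kernels of the maps `q`, and `D` handles level `0`.
  refine ⟨max (max K 1 + 1) D, fun n => ?_⟩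
  induction n with
  | zero =>
    intro a ha ha1 v
    refine (norm_le_of_isNilpotent (ha.map (levelAlgebra G 0).subtype) ha1 v).trans ?_
    exact mul_le_mul_of_nonneg_right (le_max_right _ _) (norm_nonneg _)
  | succ n ih =>
    refine (qHom G n).nilpotent_bound_of_surjective (qHom_surjective G n) (by positivity) ?_ ih
    intro z hz hznil hz1 v
    have h1 := hf n (x n) K (fun v => by simpa using hK (n + 1) v) z hz hznil hz1 v
    exact h1.trans (mul_le_mul_of_nonneg_right (le_max_left _ _) (norm_nonneg _))

/-- If the spectra of the elements of `S(G)` are determined by their components, then the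
dimensions of the minimal invariant subspaces of the levels are bounded. -/
theorem exists_finrank_bound
    (h : ∀ x : vonNeumann G, spectrum ℂ x = closure (⋃ n : ℕ, spectrum ℂ (x.1 n))) :
    ∃ m : ℕ, ∀ n (W : Submodule ℂ (EllTwoLevel d n)),
      IsMinimalInvariant (levelAlgebra G n : Set (LevelOp d n)) W → Module.finrank ℂ W ≤ m := by
  obtain ⟨N, hN⟩ := exists_nilpotent_bound h
  refine ⟨⌊N ^ 2⌋₊, fun n W hW => Nat.le_floor (hW.finrank_le_sq (hN n))⟩

end RootedTree

/-! ### Jordan's theorem on finite unitary groups -/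

section Jordan

/-- In a finite-dimensional space, a separated set of contractions has bounded cardinality. -/
theorem exists_card_bound_of_separated (k : ℕ) :
    ∃ J : ℕ, ∀ (E : Type) [NormedAddCommGroup E] [InnerProductSpace ℂ E] [FiniteDimensional ℂ E],
      Module.finrank ℂ E = k → ∀ (ι : Type) (a : ι → E →L[ℂ] E), (∀ i, ‖a i‖ ≤ 1) →
      (∀ i j, i ≠ j → 1 / 2 ≤ ‖a i - a j‖) → Finite ι ∧ Nat.card ι ≤ J := by
  let F := EuclideanSpace ℂ (Fin k)
  have : FiniteDimensional ℂ (F →L[ℂ] F) := inferInstance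
  have : ProperSpace (F →L[ℂ] F) := FiniteDimensional.proper ℂ _
  -- A ball of radius `1 / 4` contains at most one of the separated points, so the number of balls
  -- covering the compact unit ball bounds their number.
  obtain ⟨t, -, ht, hcov⟩ := Metric.finite_approx_of_totallyBounded
    (isCompact_closedBall (0 : F →L[ℂ] F) 1).totallyBounded (1 / 4) (by norm_num)
  refine ⟨Nat.card t, fun E _ _ _ hE ι a ha hsep => ?_⟩
  have := ht.to_subtype
  let e : E ≃ₗᵢ[ℂ] F := ((stdOrthonormalBasis ℂ E).reindex (finCongr hE)).repr
  let conj : (E →L[ℂ] E) →ₗ[ℂ] (F →L[ℂ] F) :=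
    { toFun := fun b => e.toContinuousLinearEquiv.toContinuousLinearMap ∘L b ∘L
        e.symm.toContinuousLinearEquiv.toContinuousLinearMap
      map_add' := fun b c => by ext1 v; simp
      map_smul' := fun b c => by ext1 v; simp }
  have hconj : ∀ b v, conj b v = e (b (e.symm v)) := fun _ _ => rfl
  have hle : ∀ b, ‖conj b‖ ≤ ‖b‖ := fun b =>
    ContinuousLinearMap.opNorm_le_bound _ (norm_nonneg _) fun v => by
      rw [hconj, e.norm_map, ← e.symm.norm_map v]
      exact b.le_opNorm _
  have hge : ∀ b, ‖b‖ ≤ ‖conj b‖ := fun b =>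
    ContinuousLinearMap.opNorm_le_bound _ (norm_nonneg _) fun v => by
      have h := (conj b).le_opNorm (e v)
      rwa [hconj, e.symm_apply_apply, e.norm_map, e.norm_map] at h
  have hc : ∀ i, ∃ c : t, dist (conj (a i)) c < 1 / 4 := fun i => by
    have := hcov (mem_closedBall_zero_iff.2 ((hle _).trans (ha i)))
    simpa using this
  choose c hc using hc
  have hinj : Function.Injective c := by
    intro i j hij
    by_contra hne
    have h1 := hsep i j hne
    have h2 := hge (a i - a j)
    rw [map_sub, ← dist_eq_norm (conj (a i))] at h2
    have h3 := dist_triangle_right (conj (a i)) (conj (a j)) (c i)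
    have h4 := hc i
    have h5 := hc j
    rw [← hij] at h5
    linarith
  exact ⟨Finite.of_injective c hinj, Nat.card_le_card_of_injective c hinj⟩

variable {E : Type*} [NormedAddCommGroup E] [InnerProductSpace ℂ E] [CompleteSpace E]

theorem norm_unitary_apply (u : unitary (E →L[ℂ] E)) (v : E) : ‖u.1 v‖ = ‖v‖ :=
  (ContinuousLinearMap.norm_map_iff_adjoint_comp_self _).2 (Unitary.coe_star_mul_self u) v

/-- Eigenvectors of a unitary operator for different eigenvalues are orthogonal. -/
theorem inner_eq_zero_of_unitary_eigenvector (u : unitary (E →L[ℂ] E)) {v w : E} {l m : ℂ}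
    (hv : u.1 v = l • v) (hw : u.1 w = m • w) (hlm : l ≠ m) : inner ℂ v w = 0 := by
  by_cases hv0 : v = 0
  · rw [hv0, inner_zero_left]
  have hl : ‖l‖ = 1 := by
    have h := norm_unitary_apply u v
    rw [hv, norm_smul] at h
    exact mul_right_cancel₀ (norm_ne_zero_iff.2 hv0) (h.trans (one_mul _).symm)
  have h1 : inner ℂ (u.1 v) (u.1 w) = inner ℂ v w := by
    rw [← ContinuousLinearMap.adjoint_inner_right, ← ContinuousLinearMap.star_eq_adjoint,
      ← mul_apply_eq_comp, Unitary.coe_star_mul_self]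
    rfl
  rw [hv, hw, inner_smul_left, inner_smul_right, ← mul_assoc] at h1
  by_contra h0
  have h2 : (starRingEnd ℂ) l * m = 1 := mul_right_cancel₀ h0 (h1.trans (one_mul _).symm)
  have h3 : (starRingEnd ℂ) l * l = 1 := by
    rw [mul_comm, Complex.mul_conj, Complex.normSq_eq_norm_sq, hl]; simp
  have hl0 : (starRingEnd ℂ) l ≠ 0 := left_ne_zero_of_mul_eq_one h3
  exact hlm (mul_left_cancel₀ hl0 (h3.trans h2.symm))

variable [FiniteDimensional ℂ E]

/-- If a unitary operator `a` commutes with its conjugate by a unitary operator `b` close to the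
identity, then `a` and `b` commute. -/
theorem commute_of_commute_conj {a b : unitary (E →L[ℂ] E)} (hb : ‖b.1 - 1‖ < 1)
    (h : Commute a (b * a * b⁻¹)) : Commute a b := by
  set a' := b * a * b⁻¹ with ha'
  suffices haa : a = a' by
    have : a * b = b * a := by
      conv_lhs => rw [haa, ha']
      group
    exact this
  have hval : ∀ u v : unitary (E →L[ℂ] E), Commute u v → Commute u.1 v.1 := fun u v huv =>
    congrArg Subtype.val huv.eq
  -- As `a` and `a'` commute, their difference is normal, so it vanishes once its spectrum is `{0}`.
  have hnormal : IsStarNormal (a.1 - a'.1) := by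
    constructor
    rw [star_sub]
    change Commute ((a⁻¹).1 - (a'⁻¹).1) (a.1 - a'.1)
    exact Commute.sub_left
      (Commute.sub_right (hval _ _ (Commute.refl a).inv_left) (hval _ _ h.inv_left))
      (Commute.sub_right (hval _ _ h.symm.inv_left) (hval _ _ (Commute.refl a').inv_left))
  have hspec : ∀ ν ∈ spectrum ℂ (a.1 - a'.1), ν = 0 := by
    intro ν hν
    by_contra hν0
    refine hν (isUnit_of_injective (z := algebraMap ℂ (E →L[ℂ] E) ν - (a.1 - a'.1)) ?_)
    by_contra hinj
    let Z : E →L[ℂ] E := algebraMap ℂ (E →L[ℂ] E) ν - (a.1 - a'.1)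
    let V : Submodule ℂ E := LinearMap.ker (Z : E →ₗ[ℂ] E)
    have hV0 : V ≠ ⊥ := fun h0 => hinj (LinearMap.ker_eq_bot.1 h0)
    have hZa : Commute Z a.1 := (Algebra.commute_algebraMap_left _ _).sub_left
      ((Commute.refl _).sub_left (hval _ _ h.symm))
    have haV : ∀ v ∈ V, a.1 v ∈ V := by
      intro v hv
      change (Z * a.1) v = 0
      have hv' : Z v = 0 := hv
      rw [hZa.eq, mul_apply_eq_comp, hv', map_zero]
    have : Nontrivial V := Submodule.nontrivial_iff_ne_bot.2 hV0
    obtain ⟨m, hm⟩ := Module.End.exists_eigenvalue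
      ((a.1 : E →ₗ[ℂ] E).restrict (p := V) (q := V) haV)
    obtain ⟨⟨w, hwV⟩, hw, hw0⟩ := hm.exists_hasEigenvector
    have haw : a.1 w = m • w := congrArg Subtype.val (Module.End.mem_eigenspace_iff.1 hw)
    have haw' : a'.1 w = (m - ν) • w := by
      have h1 : ν • w - (a.1 w - a'.1 w) = 0 := hwV
      rw [haw] at h1
      rw [sub_smul, ← sub_eq_zero, ← h1]
      abel
    -- Both `w` and `u` are eigenvectors of `a`, for the different eigenvalues `m` and `m - ν`,
    -- hence orthogonal and of equal norm. Then `‖b u - u‖ = √2 ‖u‖`, against `‖b - 1‖ < 1`.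
    let u := (b⁻¹).1 w
    have hbu : b.1 u = w := by
      change (b * b⁻¹).1 w = w
      rw [mul_inv_cancel]; rfl
    have hau : a.1 u = (m - ν) • u := by
      have h1 : a * b⁻¹ = b⁻¹ * a' := by rw [ha']; group
      have h2 := congrArg (fun x : unitary (E →L[ℂ] E) => x.1 w) h1
      change a.1 u = (b⁻¹).1 (a'.1 w) at h2
      rw [h2, haw', map_smul]
    have horth := inner_eq_zero_of_unitary_eigenvector a haw hau
      fun h0 => hν0 (sub_eq_self.1 h0.symm)
    have hu0 : 0 < ‖u‖ := by
      rw [norm_unitary_apply, norm_pos_iff]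
      exact fun h0 => hw0 (Subtype.ext h0)
    have h1 : ‖w - u‖ * ‖w - u‖ = ‖w‖ * ‖w‖ + ‖u‖ * ‖u‖ := by
      rw [sub_eq_add_neg, norm_add_sq_eq_norm_sq_add_norm_sq_of_inner_eq_zero (𝕜 := ℂ) _ _
        (by rw [inner_neg_right, horth, neg_zero]), norm_neg]
    have h2 : ‖w - u‖ < ‖u‖ := by
      calc ‖w - u‖ = ‖(b.1 - 1) u‖ := by rw [sub_apply, hbu]; rfl
        _ ≤ ‖b.1 - 1‖ * ‖u‖ := ContinuousLinearMap.le_opNorm _ _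
        _ < 1 * ‖u‖ := mul_lt_mul_of_pos_right hb hu0
        _ = ‖u‖ := one_mul _
    nlinarith [mul_self_lt_mul_self (norm_nonneg _) h2, mul_self_nonneg ‖w‖]
  have hzero : ‖a.1 - a'.1‖ₑ = 0 := by
    have h1 := hnormal.spectralRadius_eq_nnnorm
    rw [enorm_eq_nnnorm, ← h1, ← le_zero_iff]
    exact iSup₂_le fun ν hν => by rw [hspec ν hν]; simp
  exact Subtype.ext (sub_eq_zero.1 (enorm_eq_zero.1 hzero))

/-- Two elements near the identity of a finite group of unitary operators commute. -/
theorem commute_of_near_one {H : Subgroup (unitary (E →L[ℂ] E))} (hH : (H : Set (unitary (E →L[ℂ] E))).Finite)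
    {a b : unitary (E →L[ℂ] E)} (haH : a ∈ H) (hbH : b ∈ H) (ha : ‖a.1 - 1‖ < 1 / 2)
    (hb : ‖b.1 - 1‖ < 1 / 2) : Commute a b := by
  -- Iterated commutators with `a` converge geometrically to `1`, so one of them equals `1` in the
  -- finite group; commutation with `a` is then carried back down to `b`.
  let c : ℕ → unitary (E →L[ℂ] E) := fun k => Nat.rec b (fun _ x => a * x * a⁻¹ * x⁻¹) k
  have hc : ∀ k, c (k + 1) = a * c k * a⁻¹ * (c k)⁻¹ := fun _ => rfl
  have hcH : ∀ k, c k ∈ H := by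
    intro k
    induction k with
    | zero => exact hbH
    | succ k ih =>
      rw [hc]
      exact H.mul_mem (H.mul_mem (H.mul_mem haH ih) (H.inv_mem haH)) (H.inv_mem ih)
  have hnorm1 : ∀ x : unitary (E →L[ℂ] E),
      ‖(a * x * a⁻¹ * x⁻¹).1 - 1‖ ≤ 2 * ‖a.1 - 1‖ * ‖x.1 - 1‖ := by
    intro x
    have h1 : ((a * x * a⁻¹ * x⁻¹).1 - 1) * (x * a).1 = a.1 * x.1 - x.1 * a.1 := by
      have h2 : (a * x * a⁻¹ * x⁻¹) * (x * a) = a * x := by group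
      rw [sub_mul, one_mul]
      exact congrArg (fun y => y - x.1 * a.1) (congrArg Subtype.val h2)
    rw [← CStarRing.norm_mul_coe_unitary _ (x * a), h1]
    have h3 : a.1 * x.1 - x.1 * a.1 = (a.1 - 1) * (x.1 - 1) - (x.1 - 1) * (a.1 - 1) := by
      simp only [mul_sub, sub_mul, mul_one, one_mul]
      abel
    rw [h3]
    refine (norm_sub_le _ _).trans ?_
    have h4 := norm_mul_le (a.1 - 1) (x.1 - 1)
    have h5 := norm_mul_le (x.1 - 1) (a.1 - 1)
    linarith
  set r := 2 * ‖a.1 - 1‖ with hr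
  have hr0 : 0 ≤ r := by positivity
  have hr1 : r < 1 := by linarith
  have hnorm : ∀ k, ‖(c k).1 - 1‖ ≤ r ^ k := by
    intro k
    induction k with
    | zero => exact (hb.le.trans (by norm_num))
    | succ k ih =>
      rw [hc, pow_succ']
      exact (hnorm1 _).trans (mul_le_mul_of_nonneg_left ih hr0)
  have hone : ∃ k, c k = 1 := by
    have hlim : Filter.Tendsto c Filter.atTop (nhds 1) := by
      rw [tendsto_iff_dist_tendsto_zero]
      refine squeeze_zero (fun _ => dist_nonneg) (fun k => ?_)
        (tendsto_pow_atTop_nhds_zero_of_lt_one hr0 hr1)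
      rw [Subtype.dist_eq, dist_eq_norm]
      exact hnorm k
    have hmem : ((H : Set (unitary (E →L[ℂ] E))) \ {1})ᶜ ∈ nhds 1 :=
      (hH.subset Set.sdiff_subset).isClosed.isOpen_compl.mem_nhds fun h => h.2 rfl
    obtain ⟨k, hk⟩ := (hlim.eventually hmem).exists
    refine ⟨k, ?_⟩
    by_contra hne
    exact hk ⟨hcH k, hne⟩
  obtain ⟨k, hk⟩ := hone
  have hdown : ∀ j, Commute a (c (j + 1)) → Commute a (c j) := by
    intro j hj
    -- If `a` commutes with its commutator with `c j`, it commutes with `a⁻¹` times that commutator,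
    -- which is the inverse of the conjugate `c j * a * (c j)⁻¹`.
    refine commute_of_commute_conj ?_ ?_
    · refine lt_of_le_of_lt (b := r * 0 + 1 / 2) ?_ (by norm_num)
      have : ∀ j, ‖(c j).1 - 1‖ ≤ 1 / 2 := by
        intro j
        induction j with
        | zero => exact hb.le
        | succ j ih =>
          rw [hc]
          refine (hnorm1 _).trans ?_
          exact (mul_le_of_le_one_left (norm_nonneg _) hr1.le).trans ih
      simpa using this j
    · rw [hc] at hj
      have h1 : Commute a (a⁻¹ * (a * c j * a⁻¹ * (c j)⁻¹)) :=
        ((Commute.refl a).inv_right).mul_right hj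
      have h2 : a⁻¹ * (a * c j * a⁻¹ * (c j)⁻¹) = (c j * a * (c j)⁻¹)⁻¹ := by group
      rw [h2] at h1
      exact Commute.inv_right_iff.1 h1
  have hall : ∀ j, Commute a (c (k - j)) := by
    intro j
    induction j with
    | zero => rw [Nat.sub_zero, hk]; exact Commute.one_right a
    | succ j ih =>
      by_cases hjk : j < k
      · refine hdown _ ?_
        rwa [show k - (j + 1) + 1 = k - j by omega]
      · rwa [show k - (j + 1) = k - j by omega]
  have := hall k
  rwa [Nat.sub_self] at this

end Jordan

/-- **Jordan's theorem** on finite linear groups: a finite group of unitary operators has an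
abelian subgroup whose index is bounded in terms of the dimension. -/
theorem exists_index_bound_of_finite_unitary (k : ℕ) :
    ∃ J : ℕ, ∀ (E : Type) [NormedAddCommGroup E] [InnerProductSpace ℂ E] [FiniteDimensional ℂ E]
      [CompleteSpace E], Module.finrank ℂ E = k → ∀ (Γ : Type) [Group Γ]
      (θ : Γ →* unitary (E →L[ℂ] E)), (θ.range : Set (unitary (E →L[ℂ] E))).Finite →
      ∃ K : Subgroup Γ, K.FiniteIndex ∧ K.index ≤ J ∧ ∀ a ∈ K, ∀ b ∈ K, Commute (θ a) (θ b) := by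
  obtain ⟨J, hJ⟩ := exists_card_bound_of_separated k
  refine ⟨J, fun E _ _ _ _ hE Γ _ θ hθ => ?_⟩
  -- The elements of `S` commute under `θ`, hence so does the group `K` they generate.
  -- Representatives of different cosets of `K` have images at distance at least `1 / 2`, so packing
  -- bounds the index.
  let S : Set Γ := {g | ‖(θ g).1 - 1‖ < 1 / 2}
  let K := Subgroup.closure S
  have hcard := hJ E hE (Γ ⧸ K) (fun x => (θ x.out).1) ?_ ?_
  · refine ⟨K, ?_, hcard.2, fun a ha b hb => ?_⟩
    · have := hcard.1
      exact Subgroup.finiteIndex_of_finite_quotient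
    · induction ha, hb using Subgroup.closure_induction₂ with
      | mem x y hx hy => exact commute_of_near_one hθ ⟨x, rfl⟩ ⟨y, rfl⟩ hx hy
      | one_left x hx => rw [map_one]; exact Commute.one_left _
      | one_right x hx => rw [map_one]; exact Commute.one_right _
      | mul_left x y z hx hy hz h1 h2 => rw [map_mul]; exact h1.mul_left h2
      | mul_right x y z hx hy hz h1 h2 => rw [map_mul]; exact h1.mul_right h2
      | inv_left x y hx hy h => rw [map_inv]; exact h.inv_left
      | inv_right x y hx hy h => rw [map_inv]; exact h.inv_right
  · exact fun x => ContinuousLinearMap.opNorm_le_bound _ zero_le_one fun v => by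
      rw [norm_unitary_apply, one_mul]
  · intro x y hxy
    by_contra hlt
    rw [not_le] at hlt
    refine hxy ?_
    have hS : (y.out)⁻¹ * x.out ∈ S := by
      change ‖(θ (y.out⁻¹ * x.out)).1 - 1‖ < 1 / 2
      rw [← CStarRing.norm_coe_unitary_mul (θ y.out)]
      refine lt_of_eq_of_lt (congrArg norm ?_) hlt
      rw [mul_sub, mul_one]
      refine congrArg (fun z => z - (θ y.out).1) ?_
      change (θ y.out * θ (y.out⁻¹ * x.out)).1 = _
      rw [← map_mul, mul_inv_cancel_left]
    rw [← x.out_eq', ← y.out_eq']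
    exact (QuotientGroup.eq.2 (Subgroup.subset_closure hS)).symm

theorem Set.Finite.range_of_factorsThrough {X Y Z : Type*} [Nonempty X] {f : X → Y} {g : X → Z}
    (hf : (Set.range f).Finite) (h : g.FactorsThrough f) : (Set.range g).Finite := by
  have : Nonempty Z := ⟨g (Classical.arbitrary X)⟩
  refine (hf.image (Function.extend f g fun _ => Classical.arbitrary Z)).subset ?_
  rintro _ ⟨x, rfl⟩
  exact ⟨f x, ⟨x, rfl⟩, h.extend_apply _ x⟩

/-- In a finitely generated group, there are finitely many homomorphisms to a finite group. -/
theorem Group.FG.finite_monoidHom {Γ : Type*} [Group Γ] (hΓ : Group.FG Γ) (P : Type*) [Group P]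
    [Finite P] : Finite (Γ →* P) := by
  obtain ⟨S, hS⟩ := Group.fg_def.1 hΓ
  refine Finite.of_injective (fun (f : Γ →* P) (s : S) => f s) fun f g hfg => ?_
  refine MonoidHom.eq_of_eqOn_dense hS fun s hs => ?_
  exact congrFun hfg ⟨s, hs⟩

/-- A finitely generated group has a subgroup of finite index contained in all subgroups of index
at most `J`. -/
theorem Group.FG.exists_finiteIndex_le {Γ : Type*} [Group Γ] (hΓ : Group.FG Γ) (J : ℕ) :
    ∃ H : Subgroup Γ, H.FiniteIndex ∧
      ∀ K : Subgroup Γ, K.FiniteIndex → K.index ≤ J → H ≤ K := by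
  have := fun k : Fin (J + 1) => hΓ.finite_monoidHom (Equiv.Perm (Fin k))
  -- There are finitely many homomorphisms to symmetric groups of degree at most `J`, and a subgroup
  -- contains the kernel of the action on its cosets.
  refine ⟨⨅ (k : Fin (J + 1)) (f : Γ →* Equiv.Perm (Fin k)), f.ker, ?_, fun K hK hKJ => ?_⟩
  · exact Subgroup.finiteIndex_iInf fun k => Subgroup.finiteIndex_iInf fun f =>
      Subgroup.finiteIndex_ker f
  · have : Fintype (Γ ⧸ K) := Fintype.ofFinite _
    have hcard : Fintype.card (Γ ⧸ K) = K.index := by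
      rw [Subgroup.index_eq_card, Nat.card_eq_fintype_card]
    let e : (Γ ⧸ K) ≃ Fin K.index := Fintype.equivFinOfCardEq hcard
    let f : Γ →* Equiv.Perm (Fin K.index) :=
      (e.permCongrHom : Equiv.Perm (Γ ⧸ K) →* Equiv.Perm (Fin K.index)).comp
        (MulAction.toPermHom Γ (Γ ⧸ K))
    refine (iInf_le_of_le (⟨K.index, by omega⟩ : Fin (J + 1)) (iInf_le _ f)).trans fun g hg => ?_
    have h1 : MulAction.toPermHom Γ (Γ ⧸ K) g = 1 :=
      (map_eq_one_iff (e.permCongrHom) (e.permCongrHom).injective).1 hg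
    have h2 := congrArg (fun σ : Equiv.Perm (Γ ⧸ K) => σ ((1 : Γ) : Γ ⧸ K)) h1
    change ((g * 1 : Γ) : Γ ⧸ K) = ((1 : Γ) : Γ ⧸ K) at h2
    rw [mul_one, eq_comm, QuotientGroup.eq] at h2
    simpa using h2

/-! ### Jordan's theorem on invariant subspaces -/

section Subrepresentations

variable {E : Type*} [NormedAddCommGroup E] [InnerProductSpace ℂ E] [FiniteDimensional ℂ E]
  [CompleteSpace E] {Γ : Type*} [Group Γ]

/-- The restriction of a unitary representation to an invariant subspace. -/
def subrep (θ : Γ →* unitary (E →L[ℂ] E)) {W : Submodule ℂ E}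
    (hW : ∀ g, ∀ v ∈ W, (θ g).1 v ∈ W) : Γ →* unitary (W →L[ℂ] W) :=
  let τ : Γ →* (W →L[ℂ] W) :=
    { toFun := fun g => ((θ g).1 ∘L W.subtypeL).codRestrict W fun v => hW g v v.2
      map_one' := by ext v; simp
      map_mul' := fun g h => ContinuousLinearMap.ext fun v => Subtype.ext
        (congrArg (fun T : unitary (E →L[ℂ] E) => T.1 (v : E)) (map_mul θ g h)) }
  have hτ (g : Γ) : star (τ g) = τ g⁻¹ := by
    symm
    rw [ContinuousLinearMap.star_eq_adjoint, ContinuousLinearMap.eq_adjoint_iff]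
    intro x y
    change inner ℂ ((θ g⁻¹).1 (x : E)) (y : E) = inner ℂ (x : E) ((θ g).1 y)
    rw [map_inv, ← ContinuousLinearMap.adjoint_inner_left, ← ContinuousLinearMap.star_eq_adjoint]
    rfl
  MonoidHom.codRestrict τ (unitary (W →L[ℂ] W)) fun g => by
    rw [Unitary.mem_iff, hτ, ← map_mul, ← map_mul, inv_mul_cancel, mul_inv_cancel, map_one]
    exact ⟨rfl, rfl⟩

theorem coe_subrep_apply (θ : Γ →* unitary (E →L[ℂ] E)) {W : Submodule ℂ E}
    (hW : ∀ g, ∀ v ∈ W, (θ g).1 v ∈ W) (g : Γ) (v : W) :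
    ((subrep θ hW g).1 v : E) = (θ g).1 v := rfl

theorem finite_range_subrep {θ : Γ →* unitary (E →L[ℂ] E)} (hθ : (Set.range θ).Finite)
    {W : Submodule ℂ E} (hW : ∀ g, ∀ v ∈ W, (θ g).1 v ∈ W) :
    ((subrep θ hW).range : Set (unitary (W →L[ℂ] W))).Finite := by
  rw [MonoidHom.coe_range]
  refine hθ.range_of_factorsThrough fun g h hgh => ?_
  ext v
  rw [coe_subrep_apply, coe_subrep_apply, hgh]

end Subrepresentations

/-- **Jordan's theorem** for invariant subspaces of a unitary representation with finite image. -/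
theorem exists_index_bound_of_invariant (k : ℕ) :
    ∃ J : ℕ, ∀ (E : Type) [NormedAddCommGroup E] [InnerProductSpace ℂ E] [FiniteDimensional ℂ E]
      [CompleteSpace E] (W : Submodule ℂ E), Module.finrank ℂ W = k → ∀ (Γ : Type) [Group Γ]
      (θ : Γ →* unitary (E →L[ℂ] E)), (Set.range θ).Finite → (∀ g, ∀ v ∈ W, (θ g).1 v ∈ W) →
      ∃ K : Subgroup Γ, K.FiniteIndex ∧ K.index ≤ J ∧
        ∀ a ∈ K, ∀ b ∈ K, ∀ v ∈ W, (θ (a * b)).1 v = (θ (b * a)).1 v := by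
  obtain ⟨J, hJ⟩ := exists_index_bound_of_finite_unitary k
  refine ⟨J, fun E _ _ _ _ W hk Γ _ θ hθ hW => ?_⟩
  obtain ⟨K, hK, hKJ, hcomm⟩ := hJ W hk Γ (subrep θ hW) (finite_range_subrep hθ hW)
  refine ⟨K, hK, hKJ, fun a ha b hb v hv => ?_⟩
  rw [← coe_subrep_apply θ hW _ ⟨v, hv⟩, ← coe_subrep_apply θ hW _ ⟨v, hv⟩, map_mul, map_mul,
    (hcomm a ha b hb).eq]

/-! ### Bounded irreducible dimensions force virtual commutativity -/

namespace RootedTree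

variable {d : ℕ}

/-- The permutation representation on `ℓ²` of the `n`-th level, as a unitary representation. -/
def levelRepUnitary (d n : ℕ) : TreeAut d →* unitary (LevelOp d n) :=
  MonoidHom.codRestrict (levelRep d n) (unitary (LevelOp d n)) fun g => by
    rw [Unitary.mem_iff, star_levelRep, ← map_mul, ← map_mul, inv_mul_cancel, mul_inv_cancel,
      map_one]
    exact ⟨rfl, rfl⟩

theorem finite_range_levelRep (d n : ℕ) : (Set.range (levelRepUnitary d n)).Finite := by
  let σ : TreeAut d → Level d n → Level d n := fun g v => ⟨g⁻¹ v.1, by rw [aut_length, v.2]⟩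
  refine (Set.toFinite (Set.range σ)).range_of_factorsThrough fun g h hgh => ?_
  refine Subtype.ext (ContinuousLinearMap.ext fun f => ?_)
  ext v
  change levelRep d n g f v = levelRep d n h f v
  simp only [levelRep_apply]
  exact congrArg f (congrFun hgh v)

theorem eq_of_levelRep_eq {g h : TreeAut d} (hgh : ∀ n, levelRep d n g = levelRep d n h) :
    g = h := by
  rw [← inv_inj]
  ext1 v
  have h1 := congrArg (fun T => T (EuclideanSpace.single ⟨g⁻¹ v, aut_length _ _⟩ (1 : ℂ))
    ⟨v, rfl⟩) (hgh v.length)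
  simp only [levelRep_apply] at h1
  by_contra hne
  simp [Ne.symm hne] at h1

/-- If `G` is finitely generated and the dimensions of the minimal invariant subspaces of the
levels are bounded, then `G` is virtually abelian. -/
theorem isVirtuallyAbelian_of_finrank_le {G : Subgroup (TreeAut d)} (hG : G.FG) {m : ℕ}
    (hm : ∀ n (W : Submodule ℂ (EllTwoLevel d n)),
      IsMinimalInvariant (levelAlgebra G n : Set (LevelOp d n)) W → Module.finrank ℂ W ≤ m) :
    IsVirtuallyAbelian G := by
  choose J hJ using exists_index_bound_of_invariant
  -- The sum dominates the Jordan bounds of all dimensions up to `m`, so `H` lies in the Jordan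
  -- subgroup of every irreducible piece of every level.
  obtain ⟨H, hHfin, hH⟩ := ((Group.fg_iff_subgroup_fg G).2 hG).exists_finiteIndex_le
    (∑ k ∈ Finset.range (m + 1), J k)
  refine ⟨H, hHfin, fun a ha b hb => Subtype.ext (eq_of_levelRep_eq fun n => ?_)⟩
  suffices h : (⊤ : Submodule ℂ (EllTwoLevel d n)) ≤
      LinearMap.ker ((levelRep d n (a * b) - levelRep d n (b * a) : LevelOp d n) :
        EllTwoLevel d n →ₗ[ℂ] EllTwoLevel d n) by
    ext1 v
    exact sub_eq_zero.1 (h (Submodule.mem_top (x := v)))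
  refine IsInvariantUnder.induction (T := (levelAlgebra G n : Set (LevelOp d n)))
    (P := fun V => V ≤ LinearMap.ker ((levelRep d n (a * b) - levelRep d n (b * a) : LevelOp d n) :
        EllTwoLevel d n →ₗ[ℂ] EllTwoLevel d n)) (fun a ha => star_mem ha) bot_le ?_
    (fun _ _ _ _ => Submodule.mem_top)
  intro V U hU hUV ih v hv
  obtain ⟨u, hu, w, hw, rfl⟩ := U.exists_add_mem_mem_orthogonal v
  have hwV : w ∈ V := by
    have := V.sub_mem hv (hUV hu)
    rwa [add_sub_cancel_left] at this
  refine Submodule.add_mem _ ?_ (ih ⟨hw, hwV⟩)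
  obtain ⟨K, hK, hKJ, hcomm⟩ := hJ _ (EllTwoLevel d n) U rfl G
    ((levelRepUnitary d n).comp G.subtype)
    ((finite_range_levelRep d n).subset (by
      rintro _ ⟨g, rfl⟩
      exact ⟨g, rfl⟩))
    fun g => isInvariantUnder_levelAlgebra_iff.1 hU.invariant g g.2
  have hHK : H ≤ K := hH K hK (hKJ.trans (Finset.single_le_sum (f := J) (fun _ _ => Nat.zero_le _)
    (Finset.mem_range.2 (Nat.lt_succ_of_le (hm n U hU)))))
  exact sub_eq_zero.2 (hcomm a (hHK ha) b (hHK hb) u hu)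

end RootedTree

end

theorem mainTheorem4 (d : ℕ) [NeZero d] (hd : 2 ≤ d)
    (G : Subgroup (RootedTree.TreeAut d)) :
    (∀ x : RootedTree.vonNeumann G, IsStarNormal x →
      spectrum ℂ x = closure (⋃ n : ℕ, spectrum ℂ (x.1 n))) ∧
    (G.FG →
      ((∀ x : RootedTree.vonNeumann G,
          spectrum ℂ x = closure (⋃ n : ℕ, spectrum ℂ (x.1 n))) ↔
        IsVirtuallyAbelian G)) := by
  refine ⟨RootedTree.spectrum_eq_closure_of_isStarNormal, fun hG => ⟨fun h => ?_,
    RootedTree.spectrum_eq_closure_of_isVirtuallyAbelian⟩⟩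
  obtain ⟨m, hm⟩ := RootedTree.exists_finrank_bound h
  exact RootedTree.isVirtuallyAbelian_of_finrank_le hG hm
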